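/- **Setting.** Let $T>0$, let $X,Z$ be finite-dimensional real normed spaces with norms $|\cdot|$, $|\cdot|_Z$, and let $\pi\colon X\to Z$ be linear and surjective. (The locomotion case is $\dim Z<\dim X$; the statement holds for $\dim Z\le\dim X$.) *Energy.* Let $\mathcal E(t,x)=\mathcal E_{\rm sh}(t,\pi(x))$, where $\mathcal E_{\rm sh}\colon[0,T]\times Z\to[0,+\infty)$ satisfies: (E1) $\mathcal E_{\rm sh}(\cdot,z)$ is absolutely continuous on $[0,T]$ for every $z\in Z$; (E2) there is $\mu>0$ such that for all $t\in[0,T]$, $\theta\in[0,1]$, $z_1,z_2\in Z$: $\mathcal E_{\rm sh}(t,\theta z_1+(1-\theta)z_2)\le\theta\mathcal E_{\rm sh}(t,z_1)+(1-\theta)\mathcal E_{\rm sh}(t,z_2)-\frac\mu2\theta(1-\theta)|z_1-z_2|_Z^2$; (E3) $\mathcal E_{\rm sh}(t,\cdot)$ is differentiable for every $t\in[0,T]$ and $D_z\mathcal E_{\rm sh}$ is continuous on $[0,T]\times Z$; (E4) $|\partial_t\mathcal E_{\rm sh}(t,z)|\le\omega(\mathcal E_{\rm sh}(t,z))\gamma(t)$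 for a.e. $t\in[0,T]$ and every $z\in Z$, for some nondecreasing continuous $\omega\colon[0,+\infty)\to[0,+\infty)$ and some nonnegative $\gamma\in L^1(0,T)$; (E5) for every $R>0$ there is a nonnegative $\eta_R\in L^1(0,T)$ such that $|\partial_t\mathcal E_{\rm sh}(t,z_2)-\partial_t\mathcal E_{\rm sh}(t,z_1)|\le\eta_R(t)|z_2-z_1|_Z$ for a.e. $t\in[0,T]$ and all $z_1,z_2$ with $|z_1|_Z,|z_2|_Z\le R$. *Dissipation.* Let $\mathcal R(t,v)=\chi_K(v)+\mathcal R_{\rm finite}(t,v)$, where $K\subseteq X$ is a nonempty closed convex cone, $\chi_K=0$ on $K$ and $+\infty$ off $K$, and $\mathcal R_{\rm finite}\colon[0,T]\times X\to[0,+\infty)$ is such that: for every $t\in[0,T]$, $\mathcal R_{\rm finite}(t,\cdot)$ is convex and positively homogeneous of degree one, with $\mathcal R_{\rm finite}(t,0)=0$; there are $\alpha^*\ge\alpha_*>0$ with $\alpha_*|v|\le\mathcal R_{\rm finite}(t,v)\le\alpha^*|v|$ for all $(t,v)\in[0,T]\times X$; and there is a nonnegative $\rho\in L^1(0,T)$ with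 $|\mathcal R_{\rm finite}(t,v)-\mathcal R_{\rm finite}(s,v)|\le|v|\int_s^t\rho(\tau)\,d\tau$ for $0\le s\le t\le T$ and $v\in X$. Put $\mathcal R_{\rm sh}(t,z)=\inf\{\mathcal R(t,x)\mid x\in X,\ \pi(x)=z\}$. *Solutions.* Let $x_0\in X$. A *differential solution* of the quasistatic problem is an absolutely continuous $x\colon[0,T]\to X$ with $x(0)=x_0$ and $\partial_v\mathcal R(t,\dot x(t))+D_x\mathcal E(t,x(t))\ni0$ for a.e. $t\in[0,T]$, where $\partial_v$ is the convex subdifferential. For $f\colon[0,T]\to X$ and $0\le s<t\le T$, the $\mathcal R$-variation $V_{\mathcal R}(f;s,t)$ is the limit, as the mesh tends to $0$, of $\sum_{k=1}^n\mathcal R(t_{k-1},f(t_k)-f(t_{k-1}))$ over partitions $s=t_0<\dots<t_n=t$ (the upper limit, should the limit fail to exist), and $V_{\mathcal R}(f;t,t)=0$. An *energetic solution* is $x\colon[0,T]\to X$ with $V_{\mathcal R}(x;0,T)<+\infty$, $x(0)=x_0$ and, for every $t\in[0,T]$, $$\mathcal E(t,x(t))\le\mathcal E(t,v)+\mathcal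 R(t,v-x(t))\quad\text{for every }v\in X,$$ $$\mathcal E(t,x(t))+V_{\mathcal R}(x;0,t)=\mathcal E(0,x_0)+\int_0^t\partial_t\mathcal E(\tau,x(\tau))\,d\tau.$$ **Statement.** Suppose in addition that at least one of the following holds: (U1) $\mathcal R$ does not depend on time and $\mathcal E_{\rm sh}\in C^3([0,T]\times Z)$; (U2) $\mathcal R$ does not depend on time; $\mathcal E_{\rm sh}(t,z)=\mathcal V(z)-\langle g(t),z\rangle$ with $\mathcal V$ strictly convex and $g\in AC([0,T];Z^*)$; and for every $t\in[0,T]$ the stable set $\mathcal S(t)=\{z\in Z\mid\mathcal E_{\rm sh}(t,z)\le\mathcal E_{\rm sh}(t,w)+\mathcal R_{\rm sh}(w-z)\text{ for every }w\in Z\}$ is convex; (U3) $K=X$ and $\mathcal E_{\rm sh}(t,z)=\frac12\langle\mathbb A(z-\ell(t)),z-\ell(t)\rangle$ with $\mathbb A\colon Z\to Z^*$ linear, symmetric and positive definite and $\ell\in W^{1,\infty}(0,T;Z)$; and that for a.e. $t\in[0,T]$: (*) for every $z\in Z$ with $\mathcal R_{\rm sh}(t,z)<+\infty$ there is a unique $x\in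 X$ such that $\pi(x)=z$ and $\mathcal R_{\rm sh}(t,z)=\mathcal R(t,x)<\mathcal R(t,v)$ for every $v\ne x$ with $\pi(v)=z$. Then for every $x_0\in X$ the quasistatic problem has at most one differential solution and at most one energetic solution on $[0,T]$. -/

import Mathlib

open MeasureTheory Set Filter Topology
open scoped ENNReal

namespace Quasistatic

variable {X Z : Type*} [NormedAddCommGroup X] [NormedSpace ℝ X]
  [NormedAddCommGroup Z] [NormedSpace ℝ Z]

/-- Assumptions (E1)-(E5) on the shape energy `E : [0,T] × Z → [0,∞)`.
In `energy_growth` and `deriv_lipschitz` the partial derivative in time is `deriv (fun s => E s z) t`;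
by `absCont` and `deriv_lipschitz` it is a true derivative for a.e. `t` and all `z`. -/
structure IsShapeEnergy (T : ℝ) (E : ℝ → Z → ℝ) : Prop where
  nonneg : ∀ t ∈ Icc 0 T, ∀ z, 0 ≤ E t z
  /-- (E1) absolute continuity in time -/
  absCont : ∀ z, AbsolutelyContinuousOnInterval (fun t => E t z) 0 T
  /-- (E2) uniform convexity, with `μ` independent of time -/
  uniformConvex : ∃ μ : ℝ, 0 < μ ∧ ∀ t ∈ Icc 0 T, StrongConvexOn univ μ (E t)
  /-- (E3) differentiability in `z` -/
  differentiable : ∀ t ∈ Icc 0 T, Differentiable ℝ (E t)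
  /-- (E3) joint continuity of the differential in `z` -/
  continuous_fderiv :
    ContinuousOn (fun p : ℝ × Z => fderiv ℝ (E p.1) p.2) (Icc 0 T ×ˢ univ)
  /-- (E4) bound on the power of the external forces -/
  energy_growth : ∃ ω γ : ℝ → ℝ,
    (∀ r, 0 ≤ r → 0 ≤ ω r) ∧ MonotoneOn ω (Ici 0) ∧ ContinuousOn ω (Ici 0) ∧
    IntegrableOn γ (Icc 0 T) ∧ (∀ t ∈ Icc 0 T, 0 ≤ γ t) ∧
    ∀ᵐ t ∂(volume.restrict (Icc 0 T)), ∀ z, |deriv (fun s => E s z) t| ≤ ω (E t z) * γ t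
  /-- (E5) local Lipschitz continuity of the power -/
  deriv_lipschitz : ∀ R : ℝ, 0 < R → ∃ η : ℝ → ℝ,
    IntegrableOn η (Icc 0 T) ∧ (∀ t ∈ Icc 0 T, 0 ≤ η t) ∧
    ∀ᵐ t ∂(volume.restrict (Icc 0 T)),
      ∀ z₁ ∈ Metric.closedBall (0 : Z) R, ∀ z₂ ∈ Metric.closedBall (0 : Z) R,
        |deriv (fun s => E s z₂) t - deriv (fun s => E s z₁) t| ≤ η t * ‖z₂ - z₁‖

/-- Assumptions (R1)-(R3) on the finite part `Rfin : [0,T] × X → [0,∞)` of the dissipation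
potential. -/
structure IsFiniteDissipation (T : ℝ) (Rfin : ℝ → X → ℝ) : Prop where
  convex : ∀ t ∈ Icc 0 T, ConvexOn ℝ univ (Rfin t)
  homogeneous : ∀ t ∈ Icc 0 T, ∀ c : ℝ, 0 < c → ∀ v, Rfin t (c • v) = c * Rfin t v
  map_zero : ∀ t ∈ Icc 0 T, Rfin t 0 = 0
  bounds : ∃ a b : ℝ, 0 < a ∧ a ≤ b ∧
    ∀ t ∈ Icc 0 T, ∀ v, a * ‖v‖ ≤ Rfin t v ∧ Rfin t v ≤ b * ‖v‖
  time_regular : ∃ ρ : ℝ → ℝ, IntegrableOn ρ (Icc 0 T) ∧ (∀ t ∈ Icc 0 T, 0 ≤ ρ t) ∧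
    ∀ s t, 0 ≤ s → s ≤ t → t ≤ T → ∀ v, |Rfin t v - Rfin s v| ≤ ‖v‖ * ∫ τ in s..t, ρ τ

/-- A nonempty closed convex cone. -/
structure IsClosedConvexCone (K : Set X) : Prop where
  nonempty : K.Nonempty
  isClosed : IsClosed K
  convex : Convex ℝ K
  smul_mem : ∀ c : ℝ, 0 < c → ∀ v ∈ K, c • v ∈ K

open Classical in
/-- The dissipation potential `R(t,v) = χ_K(v) + Rfin(t,v)`, with values in `[0,∞]`. -/
noncomputable def dissipation (K : Set X) (Rfin : ℝ → X → ℝ) (t : ℝ) (v : X) : ℝ≥0∞ :=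
  (if v ∈ K then 0 else ⊤) + ENNReal.ofReal (Rfin t v)

/-- The energy `E(t,x) = E_sh(t,π x)`. -/
def energy (π : X →L[ℝ] Z) (E : ℝ → Z → ℝ) (t : ℝ) (x : X) : ℝ := E t (π x)

/-- The shape-restricted functional `Φ_sh(z) = inf {Φ(x) | π x = z}`. -/
noncomputable def shapeRestrict (π : X →L[ℝ] Z) (Φ : X → ℝ≥0∞) (z : Z) : ℝ≥0∞ :=
  ⨅ (x : X) (_ : π x = z), Φ x

/-- The convex subdifferential of `Φ : X → [0,∞]` at `x₀`. -/
def subdiff (Φ : X → ℝ≥0∞) (x₀ : X) : Set (X →L[ℝ] ℝ) :=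
  {ξ | ∀ x, (Φ x₀ : EReal) + ((ξ (x - x₀) : ℝ) : EReal) ≤ (Φ x : EReal)}

/-- `x` is a differential solution on `[0,T]` of `∂_v R(t, x'(t)) + D_x E(t, x(t)) ∋ 0`,
`x(0) = x₀`. -/
def IsDifferentialSolution (T : ℝ) (E : ℝ → X → ℝ) (R : ℝ → X → ℝ≥0∞) (x₀ : X)
    (x : ℝ → X) : Prop :=
  AbsolutelyContinuousOnInterval x 0 T ∧ x 0 = x₀ ∧
  ∀ᵐ t ∂(volume.restrict (Icc 0 T)), ∃ v, HasDerivAt x v t ∧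
    ∃ ξ ∈ subdiff (R t) v, ξ + fderiv ℝ (E t) (x t) = 0

/-- A partition `s = t₀ < t₁ < ⋯ < tₙ = t` of `[s,t]`; values `pt k` with `k > n` are irrelevant. -/
structure Partition (s t : ℝ) where
  n : ℕ
  pt : ℕ → ℝ
  pt_zero : pt 0 = s
  pt_last : pt n = t
  lt_succ : ∀ k < n, pt k < pt (k + 1)

/-- The filter of partitions of `[s,t]` whose mesh tends to zero. -/
def finePartitions (s t : ℝ) : Filter (Partition s t) :=
  ⨅ δ : Ioi (0 : ℝ), 𝓟 {P | ∀ k < P.n, P.pt (k + 1) - P.pt k < δ}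

/-- The sum `∑ₖ R(tₖ₋₁, f(tₖ) - f(tₖ₋₁))` over a partition. -/
noncomputable def dissipationSum (R : ℝ → X → ℝ≥0∞) (f : ℝ → X) {s t : ℝ}
    (P : Partition s t) : ℝ≥0∞ :=
  ∑ k ∈ Finset.range P.n, R (P.pt k) (f (P.pt (k + 1)) - f (P.pt k))

/-- The `R`-variation of `f` in `[s,t]`: the limit of the sums over partitions of `[s,t]` as the
mesh tends to zero. It is taken as an upper limit so that it is meaningful for every `f`; it is the
limit whenever the limit exists (`rVariation_eq_of_tendsto`), and it is `0` if `s = t`. -/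
noncomputable def rVariation (R : ℝ → X → ℝ≥0∞) (f : ℝ → X) (s t : ℝ) : ℝ≥0∞ :=
  limsup (fun P : Partition s t => dissipationSum R f P) (finePartitions s t)

theorem finePartitions_neBot {s t : ℝ} (hst : s < t) : (finePartitions s t).NeBot := by
  unfold finePartitions
  refine iInf_neBot_of_directed' ?_ ?_
  · intro a b
    refine ⟨⟨min a.1 b.1, mem_Ioi.2 (lt_min (mem_Ioi.1 a.2) (mem_Ioi.1 b.2))⟩, ?_, ?_⟩
    · exact principal_mono.2 fun P hP k hk => (hP k hk).trans_le (min_le_left _ _)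
    · exact principal_mono.2 fun P hP k hk => (hP k hk).trans_le (min_le_right _ _)
  · rintro ⟨δ, hδ⟩
    rw [principal_neBot_iff]
    obtain ⟨N, hN⟩ := exists_nat_gt ((t - s) / δ)
    have hδ' : (0 : ℝ) < δ := hδ
    have hpos : (0 : ℝ) < N := (div_pos (sub_pos.2 hst) hδ').trans hN
    have hstep : ∀ k : ℕ, (s + ((k + 1 : ℕ) : ℝ) * ((t - s) / N)) - (s + (k : ℝ) * ((t - s) / N))
        = (t - s) / N := by
      intro k; push_cast; ring
    refine ⟨⟨N, fun k => s + k * ((t - s) / N), by simp, by field_simp; ring, ?_⟩, ?_⟩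
    · intro k _
      have h1 := hstep k
      have h2 : 0 < (t - s) / N := div_pos (sub_pos.2 hst) hpos
      linarith
    · intro k _
      change (s + ((k + 1 : ℕ) : ℝ) * ((t - s) / N)) - (s + (k : ℝ) * ((t - s) / N)) < δ
      rw [hstep k, div_lt_iff₀ hpos]
      rw [div_lt_iff₀ hδ'] at hN
      linarith

theorem rVariation_eq_of_tendsto {Y : Type*} [NormedAddCommGroup Y]
    {R : ℝ → Y → ℝ≥0∞} {f : ℝ → Y} {s t : ℝ} (hst : s < t)
    {L : ℝ≥0∞}
    (h : Tendsto (fun P : Partition s t => dissipationSum R f P) (finePartitions s t) (𝓝 L)) :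
    rVariation R f s t = L := by
  have := finePartitions_neBot hst
  exact h.limsup_eq

/-- `x` is an energetic solution on `[0,T]`: `x` has bounded `R`-variation, attains the initial
position, and satisfies the global stability condition and the weak energy balance. -/
structure IsEnergeticSolution (T : ℝ) (E : ℝ → X → ℝ) (R : ℝ → X → ℝ≥0∞) (x₀ : X)
    (x : ℝ → X) : Prop where
  boundedVariation : rVariation R x 0 T < ⊤
  initial : x 0 = x₀
  stable : ∀ t ∈ Icc 0 T, ∀ v,
    ENNReal.ofReal (E t (x t)) ≤ ENNReal.ofReal (E t v) + R t (v - x t)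
  balance : ∀ t ∈ Icc 0 T,
    ((E t (x t) : ℝ) : EReal) + ((rVariation R x 0 t : ℝ≥0∞) : EReal) =
      ((E 0 x₀ + ∫ τ in (0 : ℝ)..t, deriv (fun s => E s (x τ)) τ : ℝ) : EReal)

/-- `R` does not depend on time on `[0,T]`. -/
def IsAutonomous (T : ℝ) (R : ℝ → X → ℝ≥0∞) : Prop :=
  ∀ s ∈ Icc 0 T, ∀ t ∈ Icc 0 T, ∀ v, R s v = R t v

/-- The stable set at time `t` of a shape energy `E` and a potential `Rsh` on the shape space. -/
def stableSet (E : ℝ → Z → ℝ) (Rsh : ℝ → Z → ℝ≥0∞) (t : ℝ) : Set Z :=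
  {z | ∀ w, ENNReal.ofReal (E t z) ≤ ENNReal.ofReal (E t w) + Rsh t (w - z)}

/-- (U1): autonomous dissipation and an energy of class `C³` on `[0,T] × Z`. -/
def CondU1 (T : ℝ) (E : ℝ → Z → ℝ) (R : ℝ → X → ℝ≥0∞) : Prop :=
  IsAutonomous T R ∧ ContDiffOn ℝ 3 (fun p : ℝ × Z => E p.1 p.2) (Icc 0 T ×ˢ univ)

/-- (U2): autonomous dissipation, `E_sh(t,z) = V(z) - ⟨g(t),z⟩` with `V` strictly convex and `g`
absolutely continuous, and convex stable sets (for the dissipation `R_sh` induced on `Z`). -/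
def CondU2 (T : ℝ) (π : X →L[ℝ] Z) (E : ℝ → Z → ℝ) (R : ℝ → X → ℝ≥0∞) : Prop :=
  IsAutonomous T R ∧
  (∃ (V : Z → ℝ) (g : ℝ → (Z →L[ℝ] ℝ)), StrictConvexOn ℝ univ V ∧
    AbsolutelyContinuousOnInterval g 0 T ∧ ∀ t ∈ Icc 0 T, ∀ z, E t z = V z - g t z) ∧
  ∀ t ∈ Icc 0 T, Convex ℝ (stableSet E (fun s => shapeRestrict π (R s)) t)

/-- (U3): `K = X` and a quadratic energy `E_sh(t,z) = ½⟨A(z - ℓ(t)), z - ℓ(t)⟩` with `A` symmetric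
positive definite and `ℓ ∈ W^{1,∞}(0,T;Z)`, i.e. `ℓ` is absolutely continuous with essentially
bounded derivative. -/
def CondU3 (T : ℝ) (K : Set X) (E : ℝ → Z → ℝ) : Prop :=
  K = univ ∧
  ∃ (A : Z →L[ℝ] (Z →L[ℝ] ℝ)) (l : ℝ → Z),
    (∀ z w, A z w = A w z) ∧ (∀ z, z ≠ 0 → 0 < A z z) ∧
    AbsolutelyContinuousOnInterval l 0 T ∧
    (∃ C : ℝ, ∀ᵐ t ∂(volume.restrict (Icc 0 T)), ‖deriv l t‖ ≤ C) ∧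
    ∀ t ∈ Icc 0 T, ∀ z, E t z = 1 / 2 * A (z - l t) (z - l t)

/-- Condition (∗) for a potential `Φ` on velocities: for every shape velocity `z` with
`Φ_sh(z) < ∞` there is exactly one `x` that is the strict minimiser of `Φ` over `π⁻¹(z)`. -/
def CondStar (π : X →L[ℝ] Z) (Φ : X → ℝ≥0∞) : Prop :=
  ∀ z, shapeRestrict π Φ z < ⊤ →
    ∃! x, π x = z ∧ shapeRestrict π Φ z = Φ x ∧ ∀ v, v ≠ x → π v = z → Φ x < Φ v

end Quasistatic

/-! Both notions of solution are reduced to one pointwise statement, `IsForceBalanceSolution`. It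
says that `x` is absolutely continuous and that for a.e. `t` its velocity `v` lies in `K`, `R(t,v) +
⟨DE, π v⟩ ≤ 0`, and `0 ≤ R(t,u) + ⟨DE, π u⟩` for all `u ∈ K`. Uniqueness is then proved for such
curves only.

For a differential solution this is the subdifferential inclusion tested with `0` and `v + u`. For
an energetic solution the work lies in absolute continuity. Let `D(t)` be the dissipated energy on
`[0,t]`. A bound from below valid for the sums over every partition of `[s,t]` is a bound for `D(t)
- D(s)` (`rVariation_add_le`), so only such bounds are needed, never additivity of the variation.
Stability at `s` makes the force `-DE` a lower bound for `R(s,·)` on `K`. Summation by parts carries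
this to the time-dependent sums with an error proportional to the oscillation of the shape
(`force_sub_le_sum`). Strong convexity and the energy balance then bound the squared shape increment
by its supremum times an integral, and one supremum cancels. So the shape is absolutely continuous,
and by coercivity and the balance so is the position. Left difference quotients of the balance give
the remaining inequality.

Two force-balance curves, tested with each other's velocities, satisfy `⟨DE(z) - DE(w), z' - w'⟩ ≤
0` for their shapes `z`, `w`. Each structural condition supplies a function that vanishes only when
`z = w` and cannot grow from zero. These are the quadratic energy of `z - w` (U3), the pairing
`⟨DE(z) - DE(w), z - w⟩` with Grönwall (U1), and the midpoint convexity gap of `V` (U2). Once the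
shapes agree, both velocities minimise the dissipation in the same fibre of `π`, and (∗) makes them
equal. -/

namespace Quasistatic

/-! ### Absolutely continuous curves and Grönwall's inequality -/

section AbsolutelyContinuous

variable {V W : Type*} [NormedAddCommGroup V] [NormedSpace ℝ V]
  [NormedAddCommGroup W] [NormedSpace ℝ W]

theorem absolutelyContinuousOnInterval_of_dist_le {A B : Type*} [PseudoMetricSpace A]
    [PseudoMetricSpace B] {f : ℝ → A} {g : ℝ → B} {a b : ℝ} (C : ℝ)
    (hf : AbsolutelyContinuousOnInterval f a b)
    (h : ∀ s ∈ uIcc a b, ∀ t ∈ uIcc a b, dist (g s) (g t) ≤ C * dist (f s) (f t)) :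
    AbsolutelyContinuousOnInterval g a b := by
  unfold AbsolutelyContinuousOnInterval at *
  refine squeeze_zero' ?_ ?_ (by simpa using hf.const_mul C)
  · exact Eventually.of_forall fun E => Finset.sum_nonneg fun _ _ => dist_nonneg
  · filter_upwards [mem_inf_of_right (mem_principal_self _)] with E hE
    rw [Finset.mul_sum]
    exact Finset.sum_le_sum fun i hi => h _ (hE.1 i hi).1 _ (hE.1 i hi).2

theorem _root_.LipschitzOnWith.comp_absolutelyContinuousOnInterval {A B : Type*}
    [PseudoMetricSpace A] [PseudoMetricSpace B] {φ : A → B} {S : Set A} {C : NNReal}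
    (hφ : LipschitzOnWith C φ S) {f : ℝ → A} {a b : ℝ}
    (hf : AbsolutelyContinuousOnInterval f a b) (hS : ∀ t ∈ uIcc a b, f t ∈ S) :
    AbsolutelyContinuousOnInterval (fun t => φ (f t)) a b :=
  absolutelyContinuousOnInterval_of_dist_le C hf fun s hs t ht =>
    hφ.dist_le_mul _ (hS s hs) _ (hS t ht)

theorem absolutelyContinuousOnInterval_clm_comp (φ : V →L[ℝ] W) {f : ℝ → V} {a b : ℝ}
    (hf : AbsolutelyContinuousOnInterval f a b) :
    AbsolutelyContinuousOnInterval (fun t => φ (f t)) a b :=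
  (φ.lipschitz.lipschitzOnWith (s := univ)).comp_absolutelyContinuousOnInterval hf
    fun _ _ => mem_univ _

theorem absolutelyContinuousOnInterval_prodMk {A B : Type*} [PseudoMetricSpace A]
    [PseudoMetricSpace B] {f : ℝ → A} {g : ℝ → B} {a b : ℝ}
    (hf : AbsolutelyContinuousOnInterval f a b) (hg : AbsolutelyContinuousOnInterval g a b) :
    AbsolutelyContinuousOnInterval (fun t => (f t, g t)) a b := by
  unfold AbsolutelyContinuousOnInterval at *
  refine squeeze_zero (fun E => Finset.sum_nonneg fun _ _ => dist_nonneg) (fun E => ?_)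
    (by simpa using hf.add hg)
  rw [← Finset.sum_add_distrib]
  refine Finset.sum_le_sum fun i _ => ?_
  rw [Prod.dist_eq]
  exact max_le_add_of_nonneg dist_nonneg dist_nonneg

theorem absolutelyContinuousOnInterval_id (a b : ℝ) :
    AbsolutelyContinuousOnInterval (fun t : ℝ => t) a b :=
  (LipschitzWith.id.lipschitzOnWith (s := uIcc a b)).absolutelyContinuousOnInterval

theorem intervalIntegrable_of_integrableOn_Icc {F : Type*} [NormedAddCommGroup F] {f : ℝ → F} {a b s t : ℝ}
    (hf : IntegrableOn f (Icc a b)) (hs : s ∈ Icc a b) (ht : t ∈ Icc a b) :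
    IntervalIntegrable f volume s t := by
  rw [intervalIntegrable_iff]
  refine hf.mono_set (uIoc_subset_uIcc.trans ?_)
  exact uIcc_subset_Icc hs ht

theorem absolutelyContinuousOnInterval_of_norm_sub_le_integral {F : Type*}
    [NormedAddCommGroup F] {f : ℝ → F} {m : ℝ → ℝ} {a b : ℝ} (hab : a ≤ b) (hm : IntegrableOn m (Icc a b))
    (h : ∀ s t, a ≤ s → s ≤ t → t ≤ b → ‖f t - f s‖ ≤ ∫ τ in s..t, m τ) :
    AbsolutelyContinuousOnInterval f a b := by
  have hi : ∀ {s t}, s ∈ Icc a b → t ∈ Icc a b → IntervalIntegrable m volume s t :=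
    fun hs ht => intervalIntegrable_of_integrableOn_Icc hm hs ht
  have ha : a ∈ Icc a b := left_mem_Icc.2 hab
  have hb : b ∈ Icc a b := right_mem_Icc.2 hab
  refine absolutelyContinuousOnInterval_of_dist_le 1
    ((hi ha hb).absolutelyContinuousOnInterval_intervalIntegral (c := a) (by simp)) ?_
  rw [uIcc_of_le hab]
  have key : ∀ s ∈ Icc a b, ∀ t ∈ Icc a b, s ≤ t →
      dist (f s) (f t) ≤ 1 * dist (∫ τ in a..s, m τ) (∫ τ in a..t, m τ) := by
    intro s hs t ht hst
    rw [one_mul, dist_comm, dist_eq_norm, dist_comm, Real.dist_eq,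
      intervalIntegral.integral_interval_sub_left (hi ha ht) (hi ha hs)]
    exact (h s t hs.1 hst ht.2).trans (le_abs_self _)
  intro s hs t ht
  rcases le_total s t with hst | hst
  · exact key s hs t ht hst
  · rw [dist_comm, dist_comm (∫ τ in a..s, m τ)]
    exact key t ht s hs hst

theorem ae_restrict_Icc_mem_Ioo (a b : ℝ) :
    ∀ᵐ t ∂(volume.restrict (Icc a b)), t ∈ Ioo a b := by
  have h : (volume.restrict (Icc a b) : Measure ℝ) = volume.restrict (Ioo a b) :=
    Measure.restrict_congr_set Ioo_ae_eq_Icc.symm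
  rw [h]
  exact ae_restrict_mem measurableSet_Ioo

theorem le_of_ae_deriv_nonpos {f : ℝ → ℝ} {T : ℝ}
    (hf : AbsolutelyContinuousOnInterval f 0 T)
    (h : ∀ᵐ t ∂(volume.restrict (Icc 0 T)), ∃ f', HasDerivAt f f' t ∧ f' ≤ 0) :
    ∀ t ∈ Icc 0 T, f t ≤ f 0 := by
  intro t ht
  have hsub : uIcc 0 t ⊆ uIcc 0 T := by
    rw [uIcc_of_le ht.1, uIcc_of_le (ht.1.trans ht.2)]
    exact Icc_subset_Icc_right ht.2
  have h1 := (hf.mono hsub).integral_deriv_eq_sub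
  have h2 : ∫ τ in (0 : ℝ)..t, deriv f τ ≤ 0 := by
    rw [intervalIntegral.integral_of_le ht.1]
    refine integral_nonpos_of_ae ?_
    have h3 : ∀ᵐ t ∂(volume.restrict (Icc 0 T)), deriv f t ≤ 0 := by
      filter_upwards [h] with τ hτ
      obtain ⟨f', hf', hle⟩ := hτ
      rwa [hf'.deriv]
    exact ae_restrict_of_ae_restrict_of_subset
      (Ioc_subset_Icc_self.trans (Icc_subset_Icc_right ht.2)) h3
  linarith

/-- Grönwall with integrating factor `exp (-∫ k)`. The weight `k` is only integrable and may have
any sign. The factor is absolutely continuous because `exp` is Lipschitz on the bounded range of the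
primitive of `k`. -/
theorem nonpos_of_ae_deriv_le_mul {f k : ℝ → ℝ} {T : ℝ} (hT : 0 ≤ T)
    (hf : AbsolutelyContinuousOnInterval f 0 T) (hk : IntegrableOn k (Icc 0 T))
    (h : ∀ᵐ t ∂(volume.restrict (Icc 0 T)), ∃ f', HasDerivAt f f' t ∧ f' ≤ k t * f t)
    (h0 : f 0 = 0) : ∀ t ∈ Icc 0 T, f t ≤ 0 := by
  have hki : IntervalIntegrable k volume 0 T :=
    intervalIntegrable_of_integrableOn_Icc hk (left_mem_Icc.2 hT) (right_mem_Icc.2 hT)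
  set M : ℝ → ℝ := fun t => ∫ τ in (0 : ℝ)..t, k τ with hM
  have hMac : AbsolutelyContinuousOnInterval M 0 T :=
    hki.absolutelyContinuousOnInterval_intervalIntegral (by simp)
  obtain ⟨C, hC⟩ := hMac.exists_bound
  obtain ⟨L, hL⟩ := (Real.contDiff_exp.comp contDiff_neg).contDiffOn (s := Icc (-C) C) (n := 1)
    |>.exists_lipschitzOnWith one_ne_zero (convex_Icc _ _) isCompact_Icc
  have hexp : AbsolutelyContinuousOnInterval (fun t => Real.exp (-M t)) 0 T :=
    hL.comp_absolutelyContinuousOnInterval hMac fun t ht => abs_le.1 (hC t ht)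
  have hg := hf.mul hexp
  have hle := le_of_ae_deriv_nonpos hg ?_
  · intro t ht
    have h1 := hle t ht
    simp only [Pi.mul_apply, h0, zero_mul] at h1
    by_contra! hpos
    exact absurd h1 (not_le.2 (mul_pos hpos (Real.exp_pos _)))
  · have hd := ae_restrict_of_ae (s := Icc 0 T) hki.ae_hasDerivAt_integral
    filter_upwards [h, hd, ae_restrict_mem measurableSet_Icc] with t h1 h2 ht
    obtain ⟨f', hf', hle⟩ := h1
    have h3 := h2 (by rwa [uIcc_of_le hT]) 0 (by simp)
    refine ⟨_, hf'.mul (h3.neg.exp), ?_⟩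
    have hp := Real.exp_pos (-M t)
    have : f' * Real.exp (-M t) + f t * (Real.exp (-M t) * -k t)
        = (f' - k t * f t) * Real.exp (-M t) := by ring
    refine this.trans_le ?_
    exact mul_nonpos_of_nonpos_of_nonneg (by linarith) hp.le

/-- Derivatives of absolutely continuous curves in finite dimension are dominated by an
integrable function. -/
theorem exists_integrableOn_norm_deriv_le [FiniteDimensional ℝ V] {f : ℝ → V} {T : ℝ}
    (hT : 0 ≤ T) (hf : AbsolutelyContinuousOnInterval f 0 T) :
    ∃ k : ℝ → ℝ, IntegrableOn k (Icc 0 T) ∧ ∀ t v, HasDerivAt f v t → ‖v‖ ≤ k t := by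
  let b := Module.finBasis ℝ V
  let c : ∀ i, V →L[ℝ] ℝ := fun i => LinearMap.toContinuousLinearMap (b.coord i)
  refine ⟨fun t => ∑ i, |deriv (fun s => c i (f s)) t| * ‖b i‖, ?_, ?_⟩
  · refine integrable_finsetSum _ fun i _ => ?_
    have h := (absolutelyContinuousOnInterval_clm_comp (c i) hf).intervalIntegrable_deriv
    rw [intervalIntegrable_iff_integrableOn_Icc_of_le hT] at h
    exact h.abs.mul_const _
  · intro t v hv
    have h : ∀ i, deriv (fun s => c i (f s)) t = c i v := fun i =>
      ((c i).hasFDerivAt.comp_hasDerivAt t hv).deriv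
    simp only [h]
    calc ‖v‖ = ‖∑ i, b.repr v i • b i‖ := by rw [b.sum_repr]
      _ ≤ ∑ i, ‖b.repr v i • b i‖ := norm_sum_le _ _
      _ = _ := by simp [norm_smul, c]

end AbsolutelyContinuous

end Quasistatic

/-! ### Partitions and superadditivity of the variation -/

namespace Quasistatic

namespace Partition

theorem pt_le_pt {s t : ℝ} (P : Partition s t) {i j : ℕ} (hij : i ≤ j) (hj : j ≤ P.n) :
    P.pt i ≤ P.pt j := by
  induction j, hij using Nat.le_induction with
  | base => exact le_rfl
  | succ j _ ih => exact (ih (by omega)).trans (P.lt_succ j (by omega)).le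

theorem left_le_pt {s t : ℝ} (P : Partition s t) {k : ℕ} (hk : k ≤ P.n) : s ≤ P.pt k := by
  have := P.pt_le_pt (Nat.zero_le k) hk
  rwa [P.pt_zero] at this

theorem pt_le_right {s t : ℝ} (P : Partition s t) {k : ℕ} (hk : k ≤ P.n) : P.pt k ≤ t := by
  have := P.pt_le_pt hk le_rfl
  rwa [P.pt_last] at this

/-- The partition of `[r,t]` obtained from partitions of `[r,s]` and `[s,t]`. -/
def append {r s t : ℝ} (P : Partition r s) (Q : Partition s t) : Partition r t where
  n := P.n + Q.n
  pt k := if k ≤ P.n then P.pt k else Q.pt (k - P.n)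
  pt_zero := by simp [P.pt_zero]
  pt_last := by
    rcases Nat.eq_zero_or_pos Q.n with h | h
    · have h1 := Q.pt_zero
      have h2 := Q.pt_last
      rw [h] at h2
      simp [h, P.pt_last, ← h1, ← h2]
    · rw [if_neg (by omega), Nat.add_sub_cancel_left, Q.pt_last]
  lt_succ := by
    intro k hk
    rcases lt_trichotomy k P.n with h | h | h
    · rw [if_pos h.le, if_pos (by omega)]
      exact P.lt_succ k h
    · subst h
      have := Q.lt_succ 0 (by omega)
      rw [Q.pt_zero] at this
      rw [if_pos le_rfl, if_neg (by omega), P.pt_last, Nat.add_sub_cancel_left]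
      simpa using this
    · rw [if_neg (by omega), if_neg (by omega), Nat.sub_add_comm h.le]
      exact Q.lt_succ _ (by omega)

theorem append_pt_left {r s t : ℝ} (P : Partition r s) (Q : Partition s t) {k : ℕ}
    (hk : k ≤ P.n) : (P.append Q).pt k = P.pt k := if_pos hk

theorem append_pt_right {r s t : ℝ} (P : Partition r s) (Q : Partition s t) (k : ℕ) :
    (P.append Q).pt (P.n + k) = Q.pt k := by
  rcases Nat.eq_zero_or_pos k with h | h
  · subst h
    rw [add_zero, append_pt_left P Q le_rfl, P.pt_last, Q.pt_zero]
  · change (if P.n + k ≤ P.n then _ else _) = _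
    rw [if_neg (by omega), Nat.add_sub_cancel_left]

end Partition

variable {X : Type*} [NormedAddCommGroup X]

theorem dissipationSum_append (R : ℝ → X → ℝ≥0∞) (f : ℝ → X) {r s t : ℝ} (P : Partition r s)
    (Q : Partition s t) :
    dissipationSum R f (P.append Q) = dissipationSum R f P + dissipationSum R f Q := by
  unfold dissipationSum
  rw [show (P.append Q).n = P.n + Q.n from rfl, Finset.sum_range_add]
  congr 1
  · refine Finset.sum_congr rfl fun k hk => ?_
    have := Finset.mem_range.1 hk
    rw [P.append_pt_left Q (by omega), P.append_pt_left Q (by omega)]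
  · refine Finset.sum_congr rfl fun k _ => ?_
    rw [P.append_pt_right, add_assoc, P.append_pt_right]

theorem hasBasis_finePartitions (s t : ℝ) :
    (finePartitions s t).HasBasis (fun δ : ℝ => 0 < δ)
      fun δ => {P | ∀ k < P.n, P.pt (k + 1) - P.pt k < δ} := by
  have h : finePartitions s t =
      ⨅ δ ∈ Ioi (0 : ℝ), 𝓟 {P : Partition s t | ∀ k < P.n, P.pt (k + 1) - P.pt k < δ} := by
    rw [finePartitions, iInf_subtype]
  rw [h]
  refine hasBasis_biInf_principal ?_ ⟨1, mem_Ioi.2 one_pos⟩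
  intro a ha b hb
  refine ⟨min a b, mem_Ioi.2 (lt_min (mem_Ioi.1 ha) (mem_Ioi.1 hb)), ?_, ?_⟩
  · exact fun P hP k hk => (hP k hk).trans_le (min_le_left _ _)
  · exact fun P hP k hk => (hP k hk).trans_le (min_le_right _ _)

theorem rVariation_eq_iInf (R : ℝ → X → ℝ≥0∞) (f : ℝ → X) (s t : ℝ) :
    rVariation R f s t = ⨅ (δ : ℝ) (_ : 0 < δ),
      ⨆ P ∈ {P : Partition s t | ∀ k < P.n, P.pt (k + 1) - P.pt k < δ},
        dissipationSum R f P :=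
  (hasBasis_finePartitions s t).limsup_eq_iInf_iSup

theorem exists_finePartition {s t δ : ℝ} (hst : s ≤ t) (hδ : 0 < δ) :
    ∃ P : Partition s t, ∀ k < P.n, P.pt (k + 1) - P.pt k < δ := by
  rcases hst.eq_or_lt with rfl | h
  · exact ⟨⟨0, fun _ => s, rfl, rfl, by simp⟩, by simp⟩
  · have := finePartitions_neBot h
    exact ((hasBasis_finePartitions s t).mem_of_mem hδ |> nonempty_of_mem)

/-- Superadditivity of the variation. -/
theorem rVariation_add_le {R : ℝ → X → ℝ≥0∞} {f : ℝ → X} {r s t : ℝ} (hrs : r ≤ s)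
    (hst : s ≤ t) {c : ℝ≥0∞} (hc : ∀ Q : Partition s t, c ≤ dissipationSum R f Q) :
    rVariation R f r s + c ≤ rVariation R f r t := by
  rw [rVariation_eq_iInf R f r t]
  refine le_iInf₂ fun δ hδ => ?_
  set B := ⨆ P ∈ {P : Partition r t | ∀ k < P.n, P.pt (k + 1) - P.pt k < δ},
    dissipationSum R f P
  -- One fine partition of `[s,t]` suffices: appended to any fine partition of `[r,s]`, it adds at
  -- least `c` to the sum.
  obtain ⟨Q, hQ⟩ := exists_finePartition hst hδ
  have key : ∀ P : Partition r s, (∀ k < P.n, P.pt (k + 1) - P.pt k < δ) →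
      dissipationSum R f P + c ≤ B := by
    intro P hP
    calc dissipationSum R f P + c ≤ dissipationSum R f (P.append Q) := by
          rw [dissipationSum_append]
          gcongr
          exact hc Q
      _ ≤ B := by
          refine le_iSup₂_of_le (P.append Q) ?_ le_rfl
          intro k hk
          rcases lt_or_ge k P.n with h | h
          · rw [P.append_pt_left Q (by omega), P.append_pt_left Q (by omega)]
            exact hP k h
          · obtain ⟨j, rfl⟩ := Nat.exists_eq_add_of_le h
            rw [add_assoc, P.append_pt_right, P.append_pt_right]
            exact hQ j (Nat.lt_of_add_lt_add_left hk)
  obtain ⟨P, hP⟩ := exists_finePartition hrs hδ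
  have hcB : c ≤ B := le_add_self.trans (key P hP)
  rcases eq_or_ne c ⊤ with rfl | hctop
  · rw [top_le_iff.1 hcB]
    exact le_top
  · have : rVariation R f r s ≤ B - c := by
      rw [rVariation_eq_iInf]
      refine iInf₂_le_of_le δ hδ (iSup₂_le fun P hP => ?_)
      exact ENNReal.le_sub_of_add_le_right hctop (key P hP)
    calc rVariation R f r s + c ≤ B - c + c := by gcongr
      _ = B := tsub_add_cancel_of_le hcB

end Quasistatic

/-! ### Cones, strong convexity and lower bounds for dissipation sums -/

namespace Quasistatic

variable {X Z : Type*} [NormedAddCommGroup X] [NormedSpace ℝ X]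
  [NormedAddCommGroup Z] [NormedSpace ℝ Z]

theorem IsClosedConvexCone.zero_mem {K : Set X} (hK : IsClosedConvexCone K) : (0 : X) ∈ K := by
  obtain ⟨v, hv⟩ := hK.nonempty
  have h : Tendsto (fun c : ℝ => c • v) (𝓝[>] 0) (𝓝 0) := by
    have : Tendsto (fun c : ℝ => c • v) (𝓝 0) (𝓝 ((0 : ℝ) • v)) :=
      (continuous_id.smul continuous_const).tendsto _
    rw [zero_smul] at this
    exact this.mono_left nhdsWithin_le_nhds
  refine hK.isClosed.mem_of_tendsto h ?_
  filter_upwards [self_mem_nhdsWithin] with c hc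
  exact hK.smul_mem c hc v hv

theorem IsClosedConvexCone.add_mem {K : Set X} (hK : IsClosedConvexCone K) {v w : X}
    (hv : v ∈ K) (hw : w ∈ K) : v + w ∈ K := by
  have h := hK.convex (hK.smul_mem 2 two_pos v hv) (hK.smul_mem 2 two_pos w hw)
    (a := 1 / 2) (b := 1 / 2) (by norm_num) (by norm_num) (by norm_num)
  rwa [smul_smul, smul_smul, show (1 / 2 : ℝ) * 2 = 1 by norm_num, one_smul, one_smul] at h

theorem IsClosedConvexCone.sub_mem_of_steps {K : Set X} (hK : IsClosedConvexCone K)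
    (g : ℕ → X) (n : ℕ) (h : ∀ k < n, g (k + 1) - g k ∈ K) : g n - g 0 ∈ K := by
  induction n with
  | zero => simpa using hK.zero_mem
  | succ n ih =>
    have := hK.add_mem (h n (by omega)) (ih fun k hk => h k (by omega))
    rwa [sub_add_sub_cancel] at this

theorem le_sum_steps {G : Type*} [AddCommGroup G] {φ : G → ℝ} (h0 : φ 0 ≤ 0) (hadd : ∀ v w, φ (v + w) ≤ φ v + φ w)
    (g : ℕ → G) (n : ℕ) :
    φ (g n - g 0) ≤ ∑ k ∈ Finset.range n, φ (g (k + 1) - g k) := by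
  induction n with
  | zero => simpa using h0
  | succ n ih =>
    rw [Finset.sum_range_succ]
    have := hadd (g n - g 0) (g (n + 1) - g n)
    rw [add_comm (g n - g 0), sub_add_sub_cancel] at this
    linarith

/-- Summation by parts against a nonincreasing weight. -/
theorem le_sum_antitone_mul_steps {c f : ℕ → ℝ} {F : ℝ} {n : ℕ}
    (hc : ∀ k < n, c (k + 1) ≤ c k) (hf : ∀ k ≤ n, |f k| ≤ F) (hf0 : f 0 = 0) :
    c n * f n - F * (c 0 - c n) ≤ ∑ k ∈ Finset.range n, c k * (f (k + 1) - f k) := by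
  induction n with
  | zero => simp [hf0]
  | succ n ih =>
    rw [Finset.sum_range_succ]
    have h1 := ih (fun k hk => hc k (by omega)) (fun k hk => hf k (by omega))
    have h2 := hc n (by omega)
    have h3 := abs_le.1 (hf (n + 1) le_rfl)
    nlinarith [mul_nonneg (sub_nonneg.2 h2) (by linarith [h3.1] : 0 ≤ F + f (n + 1))]

section Convexity

/-- Divide the convexity inequality on the segment from `z` to `w` by `θ` and let `θ` decrease to
`0`. -/
theorem StrongConvexOn.add_fderiv_add_le {f : Z → ℝ} {μ : ℝ} (hf : StrongConvexOn univ μ f)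
    {z : Z} {f' : Z →L[ℝ] ℝ} (hz : HasFDerivAt f f' z) (w : Z) :
    f z + f' (w - z) + μ / 2 * ‖w - z‖ ^ 2 ≤ f w := by
  have hd : HasDerivAt (fun θ : ℝ => f (z + θ • (w - z))) (f' (w - z)) 0 := by
    have h1 : HasDerivAt (fun θ : ℝ => z + θ • (w - z)) (w - z) 0 := by
      simpa using ((hasDerivAt_id (0 : ℝ)).smul_const (w - z)).const_add z
    exact HasFDerivAt.comp_hasDerivAt (f := fun θ : ℝ => z + θ • (w - z)) (0 : ℝ)
      (by simpa using hz) h1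
  have hs := hd.tendsto_slope_zero_right
  have hlim : Tendsto (fun θ : ℝ => f w - f z - (1 - θ) * (μ / 2 * ‖w - z‖ ^ 2)) (𝓝[>] 0)
      (𝓝 (f w - f z - (1 - 0) * (μ / 2 * ‖w - z‖ ^ 2))) := by
    refine Tendsto.mono_left (Continuous.tendsto ?_ 0) nhdsWithin_le_nhds
    fun_prop
  have := le_of_tendsto_of_tendsto hs hlim ?_
  · linarith
  · filter_upwards [Ioo_mem_nhdsGT (zero_lt_one (α := ℝ))] with θ hθ
    have h := hf.2 (mem_univ z) (mem_univ w) (sub_nonneg.2 hθ.2.le) hθ.1.le (by ring)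
    simp only [smul_eq_mul, zero_add, zero_smul, add_zero] at h ⊢
    rw [norm_sub_rev z w, show (1 - θ) • z + θ • w = z + θ • (w - z) by
      rw [sub_smul, one_smul, smul_sub]; abel] at h
    rw [inv_mul_le_iff₀ hθ.1]
    nlinarith

theorem mul_norm_sub_sq_le_fderiv_sub {f : Z → ℝ} {μ : ℝ} (hf : StrongConvexOn univ μ f)
    {z w : Z} {f' g' : Z →L[ℝ] ℝ} (hz : HasFDerivAt f f' z) (hw : HasFDerivAt f g' w) :
    μ * ‖z - w‖ ^ 2 ≤ (f' - g') (z - w) := by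
  have h1 := StrongConvexOn.add_fderiv_add_le hf hz w
  have h2 := StrongConvexOn.add_fderiv_add_le hf hw z
  rw [← neg_sub z w, norm_neg, map_neg] at h1
  rw [sub_apply]
  linarith

/-- Global stability along the cone directions implies the local force bound. -/
theorem nonneg_add_fderiv_of_stable {f : Z → ℝ} {z : Z} {f' : Z →L[ℝ] ℝ}
    (hz : HasFDerivAt f f' z) {u : Z} {r : ℝ} (h : ∀ θ : ℝ, 0 < θ → f z ≤ f (z + θ • u) + θ * r) :
    0 ≤ r + f' u := by
  have hd : HasDerivAt (fun θ : ℝ => f (z + θ • u)) (f' u) 0 := by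
    have h1 : HasDerivAt (fun θ : ℝ => z + θ • u) u 0 := by
      simpa using ((hasDerivAt_id (0 : ℝ)).smul_const u).const_add z
    exact HasFDerivAt.comp_hasDerivAt (f := fun θ : ℝ => z + θ • u) (0 : ℝ)
      (by simpa using hz) h1
  have := ge_of_tendsto hd.tendsto_slope_zero_right (b := -r) ?_
  · linarith
  · filter_upwards [self_mem_nhdsWithin] with θ hθ
    have hθ' : 0 < θ := hθ
    have := h θ hθ'
    simp only [zero_add, zero_smul, add_zero, smul_eq_mul]
    rw [le_inv_mul_iff₀ hθ']
    linarith

end Convexity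

section Dissipation

variable {K : Set X} {Rfin : ℝ → X → ℝ} {T : ℝ}

theorem dissipation_of_mem {Y : Type*} {K : Set Y} {Rfin : ℝ → Y → ℝ} {t : ℝ} {v : Y}
    (hv : v ∈ K) :
    dissipation K Rfin t v = ENNReal.ofReal (Rfin t v) := by
  simp [dissipation, hv]

theorem dissipation_of_notMem {Y : Type*} {K : Set Y} {Rfin : ℝ → Y → ℝ} {t : ℝ} {v : Y}
    (hv : v ∉ K) : dissipation K Rfin t v = ⊤ := by
  simp [dissipation, hv]

namespace IsFiniteDissipation

theorem add_le (hR : IsFiniteDissipation T Rfin) {t : ℝ} (ht : t ∈ Icc 0 T) (v w : X) :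
    Rfin t (v + w) ≤ Rfin t v + Rfin t w := by
  have hc := (hR.convex t ht).2
  have h := hc (mem_univ ((2 : ℝ) • v)) (mem_univ ((2 : ℝ) • w))
    (a := 1 / 2) (b := 1 / 2) (by norm_num) (by norm_num) (by norm_num)
  rw [smul_smul, smul_smul, show (1 / 2 : ℝ) * 2 = 1 by norm_num, one_smul, one_smul,
    hR.homogeneous t ht 2 two_pos, hR.homogeneous t ht 2 two_pos] at h
  simp only [smul_eq_mul] at h
  linarith

theorem nonneg (hR : IsFiniteDissipation T Rfin) {t : ℝ} (ht : t ∈ Icc 0 T) (v : X) :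
    0 ≤ Rfin t v := by
  obtain ⟨a, b, ha, _, h⟩ := hR.bounds
  exact (mul_nonneg ha.le (norm_nonneg v)).trans (h t ht v).1

end IsFiniteDissipation

/-- A single step outside `K` makes the sum infinite, so lower bounds may be proved for real sums
with all steps in `K`. -/
theorem ofReal_le_dissipationSum (hR : IsFiniteDissipation T Rfin) {f : ℝ → X} {s t c : ℝ}
    (hs : 0 ≤ s) (ht : t ≤ T) (P : Partition s t)
    (h : (∀ k < P.n, f (P.pt (k + 1)) - f (P.pt k) ∈ K) →
      c ≤ ∑ k ∈ Finset.range P.n, Rfin (P.pt k) (f (P.pt (k + 1)) - f (P.pt k))) :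
    ENNReal.ofReal c ≤ dissipationSum (dissipation K Rfin) f P := by
  unfold dissipationSum
  by_cases hK : ∀ k < P.n, f (P.pt (k + 1)) - f (P.pt k) ∈ K
  · rw [Finset.sum_congr rfl fun k hk => dissipation_of_mem (hK k (Finset.mem_range.1 hk)),
      ← ENNReal.ofReal_sum_of_nonneg]
    · exact ENNReal.ofReal_le_ofReal (h hK)
    · intro k hk
      have hk' := Finset.mem_range.1 hk
      exact hR.nonneg ⟨hs.trans (P.left_le_pt hk'.le), (P.pt_le_right hk'.le).trans ht⟩ _
  · push Not at hK
    obtain ⟨k, hk, hkK⟩ := hK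
    refine le_top.trans_eq (Eq.symm ?_)
    exact ENNReal.sum_eq_top.2 ⟨k, Finset.mem_range.2 hk, dissipation_of_notMem hkK⟩

theorem integral_le_integral_of_subinterval {ρ : ℝ → ℝ} (hρ : IntegrableOn ρ (Icc 0 T))
    (hρ0 : ∀ t ∈ Icc 0 T, 0 ≤ ρ t) {s s' t' t : ℝ} (h0 : 0 ≤ s) (h1 : s ≤ s') (h2 : s' ≤ t')
    (h3 : t' ≤ t) (h4 : t ≤ T) : ∫ τ in s'..t', ρ τ ≤ ∫ τ in s..t, ρ τ := by
  refine intervalIntegral.integral_mono_interval h1 h2 h3 ?_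
    (intervalIntegrable_of_integrableOn_Icc hρ ⟨h0, by linarith⟩ ⟨by linarith, h4⟩)
  filter_upwards [ae_restrict_mem measurableSet_Ioc] with τ hτ
  exact hρ0 τ ⟨h0.trans hτ.1.le, hτ.2.trans h4⟩

theorem integral_nonneg_of_mem_Icc {ρ : ℝ → ℝ} (hρ0 : ∀ t ∈ Icc 0 T, 0 ≤ ρ t) {s t : ℝ}
    (h0 : 0 ≤ s) (h1 : s ≤ t) (h2 : t ≤ T) : 0 ≤ ∫ τ in s..t, ρ τ :=
  intervalIntegral.integral_nonneg h1 fun τ hτ => hρ0 τ ⟨h0.trans hτ.1, hτ.2.trans h2⟩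

variable {a : ℝ} {ρ : ℝ → ℝ} {f : ℝ → X} {s t : ℝ}

theorem mul_norm_le_sum {Y : Type*} [NormedAddCommGroup Y] {Rfin : ℝ → Y → ℝ} {f : ℝ → Y}
    (ha : 0 < a) (hb : ∀ t ∈ Icc 0 T, ∀ v, a * ‖v‖ ≤ Rfin t v)
    (hs : 0 ≤ s) (ht : t ≤ T) (P : Partition s t) :
    a * ‖f t - f s‖ ≤ ∑ k ∈ Finset.range P.n, Rfin (P.pt k) (f (P.pt (k + 1)) - f (P.pt k)) := by
  have h := le_sum_steps (φ := fun v : Y => a * ‖v‖) (by simp)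
    (fun v w => by rw [← mul_add]; exact mul_le_mul_of_nonneg_left (norm_add_le _ _) ha.le)
    (fun k => f (P.pt k)) P.n
  simp only [P.pt_zero, P.pt_last] at h
  refine h.trans (Finset.sum_le_sum fun k hk => hb _ ?_ _)
  have hk' := (Finset.mem_range.1 hk).le
  exact ⟨hs.trans (P.left_le_pt hk'), (P.pt_le_right hk').trans ht⟩

/-- Subadditivity at the frozen time `t` bounds the left side by a sum of `Rfin t`. Moving each term
back to its own time costs `‖v‖ ∫ ρ`, which coercivity turns into a relative error `(∫ ρ) / a`. -/
theorem endpoint_le_mul_sum (hR : IsFiniteDissipation T Rfin) (ha : 0 < a)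
    (hb : ∀ t ∈ Icc 0 T, ∀ v, a * ‖v‖ ≤ Rfin t v)
    (hρ : IntegrableOn ρ (Icc 0 T)) (hρ0 : ∀ t ∈ Icc 0 T, 0 ≤ ρ t)
    (hreg : ∀ s t, 0 ≤ s → s ≤ t → t ≤ T → ∀ v, |Rfin t v - Rfin s v| ≤ ‖v‖ * ∫ τ in s..t, ρ τ)
    (hs : 0 ≤ s) (hst : s ≤ t) (ht : t ≤ T) (P : Partition s t) :
    Rfin t (f t - f s) ≤ (1 + (∫ τ in s..t, ρ τ) / a) *
      ∑ k ∈ Finset.range P.n, Rfin (P.pt k) (f (P.pt (k + 1)) - f (P.pt k)) := by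
  have htm : t ∈ Icc 0 T := ⟨hs.trans hst, ht⟩
  have h := le_sum_steps (hR.map_zero t htm).le (hR.add_le htm) (fun k => f (P.pt k)) P.n
  simp only [P.pt_zero, P.pt_last] at h
  refine h.trans ?_
  rw [Finset.mul_sum]
  refine Finset.sum_le_sum fun k hk => ?_
  have hk' := (Finset.mem_range.1 hk).le
  have hp1 := P.left_le_pt hk'
  have hp2 := P.pt_le_right hk'
  set v := f (P.pt (k + 1)) - f (P.pt k)
  have h1 := (abs_le.1 (hreg _ _ (hs.trans hp1) hp2 ht v)).2
  have h2 := integral_le_integral_of_subinterval hρ hρ0 hs hp1 hp2 le_rfl ht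
  have h3 := integral_nonneg_of_mem_Icc hρ0 (hs.trans hp1) hp2 ht
  have h4 := hb (P.pt k) ⟨hs.trans hp1, hp2.trans ht⟩ v
  have h5 : ‖v‖ ≤ Rfin (P.pt k) v / a := by rwa [le_div_iff₀' ha]
  have h6 : ‖v‖ * ∫ τ in P.pt k..t, ρ τ ≤ Rfin (P.pt k) v / a * ∫ τ in s..t, ρ τ :=
    mul_le_mul h5 h2 h3 ((norm_nonneg v).trans h5)
  have h7 : (1 + (∫ τ in s..t, ρ τ) / a) * Rfin (P.pt k) v
      = Rfin (P.pt k) v + Rfin (P.pt k) v / a * ∫ τ in s..t, ρ τ := by ring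
  linarith

/-- Coercivity gives `Rfin (t_k) v ≥ (1 - r_k / a) * Rfin s v ≥ (1 - r_k / a) * ξ v` with `r_k` the
integral of `ρ` over `[s, t_k]`. The weights decrease in `k`, so summation by parts leaves an error
involving only the oscillation `F` of `ξ` along the curve, not its total variation. This is what
later lets a factor cancel. -/
theorem force_sub_le_sum (ha : 0 < a) (hb : ∀ t ∈ Icc 0 T, ∀ v, a * ‖v‖ ≤ Rfin t v)
    (hρ : IntegrableOn ρ (Icc 0 T)) (hρ0 : ∀ t ∈ Icc 0 T, 0 ≤ ρ t)
    (hreg : ∀ s t, 0 ≤ s → s ≤ t → t ≤ T → ∀ v, |Rfin t v - Rfin s v| ≤ ‖v‖ * ∫ τ in s..t, ρ τ)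
    (hs : 0 ≤ s) (hst : s ≤ t) (ht : t ≤ T) (P : Partition s t)
    (hK : ∀ k < P.n, f (P.pt (k + 1)) - f (P.pt k) ∈ K)
    {ξ : X →L[ℝ] ℝ} (hξ : ∀ u ∈ K, ξ u ≤ Rfin s u) {F : ℝ}
    (hF : ∀ τ ∈ Icc s t, |ξ (f τ - f s)| ≤ F) (hr : ∫ τ in s..t, ρ τ ≤ a) :
    ξ (f t - f s) - 2 * F * (∫ τ in s..t, ρ τ) / a ≤
      ∑ k ∈ Finset.range P.n, Rfin (P.pt k) (f (P.pt (k + 1)) - f (P.pt k)) := by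
  set r := ∫ τ in s..t, ρ τ with hrdef
  have hmem : ∀ k ≤ P.n, P.pt k ∈ Icc s t := fun k hk => ⟨P.left_le_pt hk, P.pt_le_right hk⟩
  have hr0 : 0 ≤ r := integral_nonneg_of_mem_Icc hρ0 hs hst ht
  have hra : r / a ≤ 1 := (div_le_one ha).2 hr
  have habel := le_sum_antitone_mul_steps (n := P.n) (F := F)
    (c := fun k => 1 - (∫ τ in s..P.pt k, ρ τ) / a) (f := fun k => ξ (f (P.pt k) - f s))
    (fun k hk => by
      have h1 := hmem k hk.le
      have h2 := hmem (k + 1) hk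
      have := integral_le_integral_of_subinterval hρ hρ0 hs le_rfl h1.1
        (P.lt_succ k hk).le (h2.2.trans ht)
      gcongr)
    (fun k hk => hF _ (hmem k hk)) (by simp [P.pt_zero])
  simp only [P.pt_zero, P.pt_last, intervalIntegral.integral_same, zero_div, sub_zero,
    ← hrdef] at habel
  have hFt := abs_le.1 (hF t ⟨hst, le_rfl⟩)
  -- One `F * r / a` pays for the final weight `1 - r / a`, the other is the error of the summation
  -- by parts.
  have h1 : ξ (f t - f s) - 2 * F * r / a ≤
      (1 - r / a) * ξ (f t - f s) - F * (1 - (1 - r / a)) := by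
    have : 2 * F * r / a = 2 * F * (r / a) := by ring
    have h0 : 0 ≤ r / a := div_nonneg hr0 ha.le
    nlinarith [mul_nonneg h0 (sub_nonneg.2 hFt.2)]
  refine h1.trans (habel.trans (Finset.sum_le_sum fun k hk => ?_))
  have hk' := Finset.mem_range.1 hk
  obtain ⟨hp1, hp2⟩ := hmem k hk'.le
  set v := f (P.pt (k + 1)) - f (P.pt k) with hv
  have hvξ : ξ (f (P.pt (k + 1)) - f s) - ξ (f (P.pt k) - f s) = ξ v := by
    rw [← map_sub, hv]; congr 1; abel
  rw [hvξ]
  set rk := ∫ τ in s..P.pt k, ρ τ with hrk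
  have hrk0 : 0 ≤ rk := integral_nonneg_of_mem_Icc hρ0 hs hp1 (hp2.trans ht)
  have hrkr : rk ≤ r := integral_le_integral_of_subinterval hρ hρ0 hs le_rfl hp1 hp2 ht
  have hc : 0 ≤ 1 - rk / a := sub_nonneg.2 ((div_le_one ha).2 (hrkr.trans hr))
  have h2 := (abs_le.1 (hreg s (P.pt k) hs hp1 (hp2.trans ht) v)).1
  have h3 := hb s ⟨hs, hst.trans ht⟩ v
  have h4 : ‖v‖ ≤ Rfin s v / a := by rwa [le_div_iff₀' ha]
  have h5 : ‖v‖ * rk ≤ Rfin s v / a * rk := by gcongr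
  have h6 := mul_le_mul_of_nonneg_left (hξ v (hK k hk')) hc
  have h7 : (1 - rk / a) * Rfin s v = Rfin s v - Rfin s v / a * rk := by ring
  linarith

end Dissipation

end Quasistatic

/-! ### Power of the energy, and the dissipated energy of an energetic solution -/

namespace Quasistatic

variable {X Z : Type*} [NormedAddCommGroup X] [NormedSpace ℝ X]
  [NormedAddCommGroup Z] [NormedSpace ℝ Z]

section Energy

variable {T : ℝ} {E : ℝ → Z → ℝ}

namespace IsShapeEnergy

theorem hasFDerivAt (hE : IsShapeEnergy T E) {t : ℝ} (ht : t ∈ Icc 0 T) (z : Z) :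
    HasFDerivAt (E t) (fderiv ℝ (E t) z) z := (hE.differentiable t ht z).hasFDerivAt

theorem integrableOn_power (hE : IsShapeEnergy T E) (hT : 0 ≤ T) (z : Z) :
    IntegrableOn (fun τ => deriv (fun s => E s z) τ) (Icc 0 T) :=
  (intervalIntegrable_iff_integrableOn_Icc_of_le hT).1 (hE.absCont z).intervalIntegrable_deriv

theorem sub_eq_integral_power (hE : IsShapeEnergy T E) {s t : ℝ} (hs : s ∈ Icc 0 T)
    (ht : t ∈ Icc 0 T) (z : Z) :
    E t z - E s z = ∫ τ in s..t, deriv (fun s => E s z) τ := by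
  refine ((hE.absCont z).mono ?_).integral_deriv_eq_sub.symm
  rw [uIcc_of_le (hs.1.trans hs.2)]
  exact uIcc_subset_Icc hs ht

theorem exists_power_bounds (hE : IsShapeEnergy T E) (hT : 0 ≤ T) {B : ℝ} (hB : 0 < B) :
    ∃ η κ : ℝ → ℝ, IntegrableOn η (Icc 0 T) ∧ (∀ t ∈ Icc 0 T, 0 ≤ η t) ∧
      IntegrableOn κ (Icc 0 T) ∧ (∀ t ∈ Icc 0 T, 0 ≤ κ t) ∧
      ∀ᵐ t ∂(volume.restrict (Icc 0 T)),
        (∀ z₁ ∈ Metric.closedBall (0 : Z) B, ∀ z₂ ∈ Metric.closedBall (0 : Z) B,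
          |deriv (fun s => E s z₂) t - deriv (fun s => E s z₁) t| ≤ η t * ‖z₂ - z₁‖) ∧
        ∀ z ∈ Metric.closedBall (0 : Z) B, |deriv (fun s => E s z) t| ≤ κ t := by
  obtain ⟨η, hη, hη0, h⟩ := hE.deriv_lipschitz B hB
  refine ⟨η, fun t => |deriv (fun s => E s 0) t| + η t * B, hη, hη0,
    (hE.integrableOn_power hT 0).abs.add (hη.mul_const B),
    fun t ht => add_nonneg (abs_nonneg _) (mul_nonneg (hη0 t ht) hB.le), ?_⟩
  filter_upwards [h, ae_restrict_mem measurableSet_Icc] with t h1 ht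
  refine ⟨h1, fun z hz => ?_⟩
  have h2 := h1 0 (by simpa using hB.le) z hz
  rw [sub_zero] at h2
  have h3 : η t * ‖z‖ ≤ η t * B :=
    mul_le_mul_of_nonneg_left (mem_closedBall_zero_iff.1 hz) (hη0 t ht)
  have h4 := abs_sub_abs_le_abs_sub (deriv (fun s => E s z) t) (deriv (fun s => E s 0) t)
  linarith

theorem exists_norm_fderiv_le [FiniteDimensional ℝ Z] (hE : IsShapeEnergy T E) (B : ℝ) :
    ∃ L : ℝ, 0 ≤ L ∧ ∀ t ∈ Icc 0 T, ∀ z ∈ Metric.closedBall (0 : Z) B,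
      ‖fderiv ℝ (E t) z‖ ≤ L := by
  have : ProperSpace Z := FiniteDimensional.proper ℝ Z
  obtain ⟨L, hL⟩ := (isCompact_Icc.prod (isCompact_closedBall (0 : Z) B)).exists_bound_of_continuousOn
    (hE.continuous_fderiv.mono (prod_mono_right (subset_univ _)))
  exact ⟨max L 0, le_max_right _ _, fun t ht z hz => (hL (t, z) ⟨ht, hz⟩).trans (le_max_left _ _)⟩

/-- Measurability of the power along a measurable curve. -/
theorem aestronglyMeasurable_power [FiniteDimensional ℝ Z] (hE : IsShapeEnergy T E) {z : ℝ → Z}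
    (hz : AEStronglyMeasurable z (volume.restrict (Icc 0 T))) :
    AEStronglyMeasurable (fun τ => deriv (fun s => E s (z τ)) τ) (volume.restrict (Icc 0 T)) := by
  have : ProperSpace Z := FiniteDimensional.proper ℝ Z
  borelize Z
  have h : ∀ᵐ t ∂(volume.restrict (Icc 0 T)), Continuous fun z => deriv (fun s => E s z) t := by
    have h1 : ∀ n : ℕ, ∃ η : ℝ → ℝ, ∀ᵐ t ∂(volume.restrict (Icc 0 T)),
      ∀ z₁ ∈ Metric.closedBall (0 : Z) (n + 1), ∀ z₂ ∈ Metric.closedBall (0 : Z) (n + 1),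
        |deriv (fun s => E s z₂) t - deriv (fun s => E s z₁) t| ≤ η t * ‖z₂ - z₁‖ := by
      intro n
      obtain ⟨η, _, _, h⟩ := hE.deriv_lipschitz (n + 1) (by positivity)
      exact ⟨η, h⟩
    choose η hη using h1
    filter_upwards [ae_all_iff.2 hη] with t ht
    rw [continuous_iff_continuousAt]
    intro w
    obtain ⟨n, hn⟩ := exists_nat_gt ‖w‖
    have hball : Metric.closedBall (0 : Z) (n + 1) ∈ 𝓝 w := by
      refine Metric.closedBall_mem_nhds_of_mem ?_
      rw [mem_ball_zero_iff]; linarith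
    rw [ContinuousAt, tendsto_iff_dist_tendsto_zero]
    refine squeeze_zero' (Eventually.of_forall fun _ => dist_nonneg)
      (g := fun z => η n t * ‖z - w‖) ?_ ?_
    · filter_upwards [hball] with z hz
      exact ht n w (mem_of_mem_nhds hball) z hz
    · have : Continuous fun z => η n t * ‖z - w‖ := by fun_prop
      simpa using this.tendsto w
  obtain ⟨G, hG, hGm, hGc⟩ := h.exists_measurable_mem
  have hu : StronglyMeasurable (Function.uncurry fun (w : Z) (t : ℝ) =>
      G.indicator (fun t => deriv (fun s => E s w) t) t) := by
    refine stronglyMeasurable_uncurry_of_continuous_of_stronglyMeasurable ?_ ?_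
    · intro t
      by_cases ht : t ∈ G
      · simpa [ht] using hGc t ht
      · simpa [ht] using continuous_const
    · exact fun w => ((measurable_deriv _).indicator hGm).stronglyMeasurable
  have h2 : AEMeasurable (fun τ => (z τ, τ)) (volume.restrict (Icc 0 T)) :=
    hz.aemeasurable.prodMk aemeasurable_id
  refine (hu.measurable.comp_aemeasurable h2).aestronglyMeasurable.congr ?_
  filter_upwards [hG] with τ hτ
  simp [hτ]

end IsShapeEnergy

end Energy

/-- Absolutely continuous solutions of the force balance, written with the finite part of the
dissipation. -/
def IsForceBalanceSolution (T : ℝ) (π : X →L[ℝ] Z) (E : ℝ → Z → ℝ) (K : Set X)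
    (Rfin : ℝ → X → ℝ) (x : ℝ → X) : Prop :=
  AbsolutelyContinuousOnInterval x 0 T ∧
  ∀ᵐ t ∂(volume.restrict (Icc 0 T)), ∃ v, HasDerivAt x v t ∧ v ∈ K ∧
    Rfin t v + fderiv ℝ (E t) (π (x t)) (π v) ≤ 0 ∧
    ∀ u ∈ K, 0 ≤ Rfin t u + fderiv ℝ (E t) (π (x t)) (π u)

/-- With `N` the supremum of `m`, the hypothesis gives `N² ≤ N c`, hence `N ≤ c`. If `N = 0`,
applying it with the bound `1` gives `0 ≤ c`. -/
theorem le_of_forall_sq_le_mul {m : ℝ → ℝ} {S : Set ℝ} {c : ℝ} (hm : ∀ τ ∈ S, 0 ≤ m τ)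
    (hb : BddAbove (m '' S))
    (h : ∀ N, 0 ≤ N → (∀ τ ∈ S, m τ ≤ N) → ∀ τ ∈ S, m τ ^ 2 ≤ N * c) {τ : ℝ} (hτ : τ ∈ S) :
    m τ ≤ c := by
  set N := sSup (m '' S)
  have hN : ∀ τ ∈ S, m τ ≤ N := fun τ hτ => le_csSup hb (mem_image_of_mem _ hτ)
  have hN0 : 0 ≤ N := (hm τ hτ).trans (hN τ hτ)
  have h1 : N ≤ √(N * c) := by
    refine csSup_le ⟨_, mem_image_of_mem _ hτ⟩ ?_
    rintro _ ⟨σ, hσ, rfl⟩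
    exact Real.le_sqrt_of_sq_le (h N hN0 hN σ hσ)
  rcases hN0.eq_or_lt with h0 | hpos
  · have h2 := h 1 zero_le_one (fun σ hσ => (hN σ hσ).trans (by linarith)) τ hτ
    have h3 := hN τ hτ
    have h4 := hm τ hτ
    nlinarith [sq_nonneg (m τ)]
  · have h2 : 0 < N * c := by
      by_contra! hle
      rw [Real.sqrt_eq_zero_of_nonpos hle] at h1
      linarith
    have h3 := Real.sq_sqrt h2.le
    have h4 : N ^ 2 ≤ N * c := h3 ▸ pow_le_pow_left₀ hN0 h1 2
    have h5 : N ≤ c := by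
      rw [sq] at h4
      exact le_of_mul_le_mul_left h4 hpos
    exact (hN τ hτ).trans h5

section Energetic

variable {T : ℝ} {π : X →L[ℝ] Z} {E : ℝ → Z → ℝ} {K : Set X} {Rfin : ℝ → X → ℝ} {x₀ : X}
  {x : ℝ → X}

/-- The balance equates the variation plus a real number to a real number, so the variation is
finite at every time and can be replaced by a real function `D`. -/
theorem IsEnergeticSolution.exists_dissipated_energy
    (hx : IsEnergeticSolution T (energy π E) (dissipation K Rfin) x₀ x) :
    ∃ D : ℝ → ℝ,
      (∀ t ∈ Icc 0 T, E t (π (x t)) + D t =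
        E 0 (π x₀) + ∫ τ in (0 : ℝ)..t, deriv (fun s => E s (π (x τ))) τ) ∧
      ∀ s t, 0 ≤ s → s ≤ t → t ≤ T → ∀ c : ℝ,
        (∀ Q : Partition s t, ENNReal.ofReal c ≤ dissipationSum (dissipation K Rfin) x Q) →
        c ≤ D t - D s := by
  have hne : ∀ t ∈ Icc 0 T, rVariation (dissipation K Rfin) x 0 t ≠ ⊤ := by
    intro t ht h
    have := hx.balance t ht
    rw [h, EReal.coe_ennreal_top, EReal.coe_add_top] at this
    exact EReal.top_ne_coe _ this
  refine ⟨fun t => (rVariation (dissipation K Rfin) x 0 t).toReal, ?_, ?_⟩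
  · intro t ht
    have := hx.balance t ht
    rw [← ENNReal.ofReal_toReal (hne t ht), EReal.coe_ennreal_ofReal,
      max_eq_left ENNReal.toReal_nonneg] at this
    exact_mod_cast this
  · intro s t hs hst ht c hc
    have h := rVariation_add_le hs hst hc
    have hs' := hne s ⟨hs, hst.trans ht⟩
    have ht' := hne t ⟨hs.trans hst, ht⟩
    have h2 := ENNReal.toReal_mono ht' h
    rw [ENNReal.toReal_add hs' ENNReal.ofReal_ne_top, ENNReal.toReal_ofReal'] at h2
    linarith [le_max_left c 0]

/-- `D` is monotone, hence continuous off a countable set, and `x` inherits this continuity. -/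
theorem aestronglyMeasurable_of_mul_norm_sub_le [FiniteDimensional ℝ X] {D : ℝ → ℝ} {a : ℝ}
    (ha : 0 < a) (h : ∀ s t, 0 ≤ s → s ≤ t → t ≤ T → a * ‖x t - x s‖ ≤ D t - D s) :
    AEStronglyMeasurable x (volume.restrict (Icc 0 T)) := by
  have : ProperSpace X := FiniteDimensional.proper ℝ X
  have hmono : MonotoneOn D (Icc 0 T) := fun s hs t ht hst => by
    have := h s t hs.1 hst ht.2
    have h2 : 0 ≤ a * ‖x t - x s‖ := by positivity
    linarith
  set S := {τ ∈ Icc 0 T | ¬ContinuousWithinAt D (Icc 0 T) τ}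
  have hS : S.Countable := hmono.countable_not_continuousWithinAt
  have hle : ∀ s ∈ Icc 0 T, ∀ t ∈ Icc 0 T, dist (x s) (x t) ≤ a⁻¹ * dist (D s) (D t) := by
    have key : ∀ s ∈ Icc 0 T, ∀ t ∈ Icc 0 T, s ≤ t →
        dist (x s) (x t) ≤ a⁻¹ * dist (D s) (D t) := by
      intro s hs t ht hst
      rw [le_inv_mul_iff₀ ha, dist_comm, dist_eq_norm, dist_comm, Real.dist_eq]
      exact (h s t hs.1 hst ht.2).trans (le_abs_self _)
    intro s hs t ht
    rcases le_total s t with hst | hst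
    · exact key s hs t ht hst
    · rw [dist_comm, dist_comm (D s)]
      exact key t ht s hs hst
  have hc : ContinuousOn x (Icc 0 T \ S) := by
    intro t ht
    have hD : ContinuousWithinAt D (Icc 0 T) t := by
      by_contra hcon
      exact ht.2 ⟨ht.1, hcon⟩
    have hD' := (hD.mono (sdiff_subset (t := S)))
    rw [ContinuousWithinAt, tendsto_iff_dist_tendsto_zero] at hD' ⊢
    refine squeeze_zero' (Eventually.of_forall fun _ => dist_nonneg) ?_
      (by simpa using hD'.const_mul a⁻¹)
    filter_upwards [self_mem_nhdsWithin] with s hs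
    exact hle s hs.1 t ht.1
  have hm := hc.aestronglyMeasurable (μ := volume) (measurableSet_Icc.diff hS.measurableSet)
  rwa [Measure.restrict_congr_set (sdiff_null_ae_eq_self (hS.measure_zero _))] at hm

end Energetic

end Quasistatic

/-! ### Regularity and force balance of energetic solutions -/

namespace Quasistatic

variable {X Z : Type*} [NormedAddCommGroup X] [NormedSpace ℝ X]
  [NormedAddCommGroup Z] [NormedSpace ℝ Z]

/-- At a frozen shape `w` the power integrates exactly to an energy increment; the Lipschitz bound
controls the cost of freezing. -/
theorem IsShapeEnergy.abs_integral_power_sub_le {T : ℝ} {E : ℝ → Z → ℝ} (hE : IsShapeEnergy T E)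
    {z : ℝ → Z} {B : ℝ} {η : ℝ → ℝ} (hη : IntegrableOn η (Icc 0 T))
    (hη0 : ∀ t ∈ Icc 0 T, 0 ≤ η t)
    (hpow : ∀ᵐ t ∂(volume.restrict (Icc 0 T)), ∀ z₁ ∈ Metric.closedBall (0 : Z) B,
      ∀ z₂ ∈ Metric.closedBall (0 : Z) B,
        |deriv (fun s => E s z₂) t - deriv (fun s => E s z₁) t| ≤ η t * ‖z₂ - z₁‖)
    (hq : IntegrableOn (fun τ => deriv (fun s => E s (z τ)) τ) (Icc 0 T))
    (hz : ∀ t ∈ Icc 0 T, ‖z t‖ ≤ B) {s t : ℝ} (hs : 0 ≤ s) (hst : s ≤ t) (ht : t ≤ T)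
    {w : Z} (hw : ‖w‖ ≤ B) {N : ℝ} (hN : ∀ τ ∈ Icc s t, ‖z τ - w‖ ≤ N) :
    |(∫ τ in s..t, deriv (fun s => E s (z τ)) τ) - (E t w - E s w)| ≤ N * ∫ τ in s..t, η τ := by
  have hsm : s ∈ Icc 0 T := ⟨hs, hst.trans ht⟩
  have htm : t ∈ Icc 0 T := ⟨hs.trans hst, ht⟩
  rw [hE.sub_eq_integral_power hsm htm,
    ← intervalIntegral.integral_sub (intervalIntegrable_of_integrableOn_Icc hq hsm htm)
      (intervalIntegrable_of_integrableOn_Icc (hE.integrableOn_power (hs.trans (hst.trans ht)) w)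
        hsm htm),
    ← intervalIntegral.integral_const_mul, ← Real.norm_eq_abs]
  refine intervalIntegral.norm_integral_le_of_norm_le hst ?_
    ((intervalIntegrable_of_integrableOn_Icc hη hsm htm).const_mul N)
  have h1 := (ae_restrict_iff' measurableSet_Icc).1 hpow
  filter_upwards [h1] with τ h1 hτ
  have hτm : τ ∈ Icc 0 T := ⟨hs.trans hτ.1.le, hτ.2.trans ht⟩
  have h2 := h1 hτm w (mem_closedBall_zero_iff.2 hw) (z τ) (mem_closedBall_zero_iff.2 (hz τ hτm))
  rw [Real.norm_eq_abs]
  refine h2.trans ?_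
  rw [mul_comm]
  exact mul_le_mul_of_nonneg_right (hN τ (Ioc_subset_Icc_self hτ)) (hη0 τ hτm)

section Energetic

variable {T : ℝ} {π : X →L[ℝ] Z} {E : ℝ → Z → ℝ} {K : Set X} {Rfin : ℝ → X → ℝ} {x₀ : X}
  {x : ℝ → X} {D : ℝ → ℝ}

theorem IsEnergeticSolution.energy_le
    (hx : IsEnergeticSolution T (energy π E) (dissipation K Rfin) x₀ x) (hE : IsShapeEnergy T E)
    (hR : IsFiniteDissipation T Rfin) {t : ℝ} (ht : t ∈ Icc 0 T) {u : X} (hu : u ∈ K) :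
    E t (π (x t)) ≤ E t (π (x t) + π u) + Rfin t u := by
  have h := hx.stable t ht (x t + u)
  simp only [energy, map_add] at h
  rw [add_sub_cancel_left, dissipation_of_mem hu,
    ← ENNReal.ofReal_add (hE.nonneg t ht _) (hR.nonneg ht u)] at h
  exact (ENNReal.ofReal_le_ofReal_iff (add_nonneg (hE.nonneg t ht _) (hR.nonneg ht u))).1 h

theorem IsEnergeticSolution.nonneg_force
    (hx : IsEnergeticSolution T (energy π E) (dissipation K Rfin) x₀ x) (hE : IsShapeEnergy T E)
    (hK : IsClosedConvexCone K) (hR : IsFiniteDissipation T Rfin) {t : ℝ} (ht : t ∈ Icc 0 T)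
    {u : X} (hu : u ∈ K) : 0 ≤ Rfin t u + fderiv ℝ (E t) (π (x t)) (π u) := by
  refine nonneg_add_fderiv_of_stable (hE.hasFDerivAt ht _) fun θ hθ => ?_
  have := hx.energy_le hE hR ht (hK.smul_mem θ hθ u hu)
  rwa [map_smul, hR.homogeneous t ht θ hθ] at this

/-- Increments of the dissipated energy control the increments of the shape, on intervals where
the dissipation potential varies little. -/
theorem IsEnergeticSolution.norm_shape_sub_le_of_integral_le
    (hx : IsEnergeticSolution T (energy π E) (dissipation K Rfin) x₀ x) (hE : IsShapeEnergy T E)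
    (hK : IsClosedConvexCone K) (hR : IsFiniteDissipation T Rfin)
    (hbal : ∀ t ∈ Icc 0 T, E t (π (x t)) + D t =
        E 0 (π x₀) + ∫ τ in (0 : ℝ)..t, deriv (fun s => E s (π (x τ))) τ)
    (hD : ∀ s t, 0 ≤ s → s ≤ t → t ≤ T → ∀ c : ℝ,
        (∀ Q : Partition s t, ENNReal.ofReal c ≤ dissipationSum (dissipation K Rfin) x Q) →
        c ≤ D t - D s)
    {a : ℝ} (ha : 0 < a) (hb : ∀ t ∈ Icc 0 T, ∀ v, a * ‖v‖ ≤ Rfin t v)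
    {ρ : ℝ → ℝ} (hρ : IntegrableOn ρ (Icc 0 T)) (hρ0 : ∀ t ∈ Icc 0 T, 0 ≤ ρ t)
    (hreg : ∀ s t, 0 ≤ s → s ≤ t → t ≤ T → ∀ v, |Rfin t v - Rfin s v| ≤ ‖v‖ * ∫ τ in s..t, ρ τ)
    {B : ℝ} (hz : ∀ t ∈ Icc 0 T, ‖π (x t)‖ ≤ B) {η : ℝ → ℝ} (hη : IntegrableOn η (Icc 0 T))
    (hη0 : ∀ t ∈ Icc 0 T, 0 ≤ η t)
    (hpow : ∀ᵐ t ∂(volume.restrict (Icc 0 T)), ∀ z₁ ∈ Metric.closedBall (0 : Z) B,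
      ∀ z₂ ∈ Metric.closedBall (0 : Z) B,
        |deriv (fun s => E s z₂) t - deriv (fun s => E s z₁) t| ≤ η t * ‖z₂ - z₁‖)
    (hq : IntegrableOn (fun τ => deriv (fun s => E s (π (x τ))) τ) (Icc 0 T))
    {L : ℝ} (hL : ∀ t ∈ Icc 0 T, ∀ z ∈ Metric.closedBall (0 : Z) B, ‖fderiv ℝ (E t) z‖ ≤ L)
    {μ : ℝ} (hμ : 0 < μ) (hconv : ∀ t ∈ Icc 0 T, StrongConvexOn univ μ (E t))
    {s t : ℝ} (hs : 0 ≤ s) (hst : s ≤ t) (ht : t ≤ T) (hr : ∫ τ in s..t, ρ τ ≤ a) :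
    ‖π (x t) - π (x s)‖ ≤
      2 / μ * (2 * (∫ τ in s..t, η τ) + 2 * L / a * ∫ τ in s..t, ρ τ) := by
  have hsm : s ∈ Icc 0 T := ⟨hs, hst.trans ht⟩
  have hL0 : 0 ≤ L := (norm_nonneg _).trans (hL s hsm _ (mem_closedBall_zero_iff.2 (hz s hsm)))
  refine le_of_forall_sq_le_mul (m := fun τ => ‖π (x τ) - π (x s)‖) (S := Icc s t)
    (fun _ _ => norm_nonneg _) ?_ ?_ (right_mem_Icc.2 hst)
  · refine ⟨B + B, ?_⟩
    rintro _ ⟨τ, hτ, rfl⟩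
    exact (norm_sub_le _ _).trans
      (add_le_add (hz τ ⟨hs.trans hτ.1, hτ.2.trans ht⟩) (hz s hsm))
  · intro N hN0 hN τ hτ
    have hτT : τ ≤ T := hτ.2.trans ht
    have hτm : τ ∈ Icc 0 T := ⟨hs.trans hτ.1, hτT⟩
    have hητ := integral_le_integral_of_subinterval hη hη0 hs le_rfl hτ.1 hτ.2 ht
    have hρτ := integral_le_integral_of_subinterval hρ hρ0 hs le_rfl hτ.1 hτ.2 ht
    set DE := fderiv ℝ (E s) (π (x s)) with hDE
    -- Stability at `s` makes `-DE ∘ π` admissible as `ξ`, and it oscillates by at most `L * N`.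
    have h1 : (-(DE.comp π)) (x τ - x s) - 2 * (L * N) * (∫ σ in s..τ, ρ σ) / a ≤ D τ - D s := by
      refine hD s τ hs hτ.1 hτT _ fun Q => ?_
      refine ofReal_le_dissipationSum hR hs hτT Q fun hQ => ?_
      refine force_sub_le_sum ha hb hρ hρ0 hreg hs hτ.1 hτT Q hQ ?_ ?_ (hρτ.trans hr)
      · intro u hu
        have := hx.nonneg_force hE hK hR hsm hu
        simp only [neg_apply, ContinuousLinearMap.comp_apply]
        linarith
      · intro σ hσ
        simp only [neg_apply, ContinuousLinearMap.comp_apply, abs_neg, map_sub π]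
        rw [← Real.norm_eq_abs]
        refine (DE.le_opNorm _).trans ?_
        exact mul_le_mul (hL s hsm _ (mem_closedBall_zero_iff.2 (hz s hsm)))
          (hN σ ⟨hσ.1, hσ.2.trans hτ.2⟩) (norm_nonneg _) hL0
    simp only [neg_apply, ContinuousLinearMap.comp_apply, map_sub π] at h1
    have h2 := StrongConvexOn.add_fderiv_add_le (hconv s hsm) (hE.hasFDerivAt hsm (π (x s)))
      (π (x τ))
    have h3 := (abs_le.1 (hE.abs_integral_power_sub_le hη hη0 hpow hq hz hs hτ.1 hτT (hz τ hτm)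
      (N := 2 * N) fun σ hσ => by
        have e1 := hN σ ⟨hσ.1, hσ.2.trans hτ.2⟩
        have e2 := hN τ hτ
        rw [← sub_sub_sub_cancel_right (π (x σ)) (π (x τ)) (π (x s))]
        exact (norm_sub_le _ _).trans (by linarith))).2
    have h4 := hbal s hsm
    have h5 := hbal τ hτm
    have h6 := intervalIntegral.integral_add_adjacent_intervals
      (intervalIntegrable_of_integrableOn_Icc hq (left_mem_Icc.2 (hs.trans (hst.trans ht))) hsm)
      (intervalIntegrable_of_integrableOn_Icc hq hsm hτm)
    have h7 : 2 * N * ∫ σ in s..τ, η σ ≤ 2 * N * ∫ σ in s..t, η σ :=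
      mul_le_mul_of_nonneg_left hητ (by positivity)
    have h8 : 2 * (L * N) * (∫ σ in s..τ, ρ σ) / a ≤ 2 * (L * N) * (∫ σ in s..t, ρ σ) / a := by
      gcongr
    have h9 : μ / 2 * ‖π (x τ) - π (x s)‖ ^ 2 ≤
        2 * N * (∫ σ in s..t, η σ) + 2 * (L * N) * (∫ σ in s..t, ρ σ) / a := by
      linarith
    have h10 : N * (2 / μ * (2 * (∫ τ in s..t, η τ) + 2 * L / a * ∫ τ in s..t, ρ τ)) =
        2 / μ * (2 * N * (∫ σ in s..t, η σ) + 2 * (L * N) * (∫ σ in s..t, ρ σ) / a) := by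
      ring
    rw [h10]
    calc ‖π (x τ) - π (x s)‖ ^ 2 = 2 / μ * (μ / 2 * ‖π (x τ) - π (x s)‖ ^ 2) := by
          field_simp
      _ ≤ _ := by gcongr

/-- Energetic solutions are absolutely continuous and satisfy the force balance. -/
theorem IsEnergeticSolution.isForceBalanceSolution [FiniteDimensional ℝ X] [FiniteDimensional ℝ Z]
    (hT : 0 < T)
    (hx : IsEnergeticSolution T (energy π E) (dissipation K Rfin) x₀ x) (hE : IsShapeEnergy T E)
    (hK : IsClosedConvexCone K) (hR : IsFiniteDissipation T Rfin) :
    IsForceBalanceSolution T π E K Rfin x := by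
  obtain ⟨D, hbal, hD⟩ := hx.exists_dissipated_energy
  obtain ⟨a, b, ha, -, hab⟩ := hR.bounds
  have hb : ∀ t ∈ Icc 0 T, ∀ v, a * ‖v‖ ≤ Rfin t v := fun t ht v => (hab t ht v).1
  obtain ⟨ρ, hρ, hρ0, hreg⟩ := hR.time_regular
  obtain ⟨μ, hμ, hconv⟩ := hE.uniformConvex
  have h0m : (0 : ℝ) ∈ Icc 0 T := left_mem_Icc.2 hT.le
  have hinc : ∀ s t, 0 ≤ s → s ≤ t → t ≤ T → a * ‖x t - x s‖ ≤ D t - D s :=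
    fun s t hs hst ht => hD s t hs hst ht _ fun Q =>
      ofReal_le_dissipationSum hR hs ht Q fun _ => mul_norm_le_sum ha hb hs ht Q
  have hmem : ∀ s t, 0 ≤ s → s ≤ t → t ≤ T → x t - x s ∈ K := by
    intro s t hs hst ht
    by_contra hcon
    -- If the increment is not in `K`, every partition has a step outside `K`, so any number bounds
    -- its sum from below; this one is absurd.
    have := hD s t hs hst ht (D t - D s + 1) fun Q => by
      refine ofReal_le_dissipationSum hR hs ht Q fun hQ => absurd ?_ hcon
      have := hK.sub_mem_of_steps (fun k => x (Q.pt k)) Q.n hQ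
      rwa [Q.pt_zero, Q.pt_last] at this
    linarith
  have hend : ∀ s t, 0 ≤ s → s ≤ t → t ≤ T →
      Rfin t (x t - x s) ≤ (1 + (∫ τ in s..t, ρ τ) / a) * (D t - D s) := by
    intro s t hs hst ht
    have hp : 0 < 1 + (∫ τ in s..t, ρ τ) / a := by
      have := integral_nonneg_of_mem_Icc hρ0 hs hst ht
      positivity
    rw [← div_le_iff₀' hp]
    refine hD s t hs hst ht _ fun Q => ofReal_le_dissipationSum hR hs ht Q fun _ => ?_
    rw [div_le_iff₀' hp]
    exact endpoint_le_mul_sum hR ha hb hρ hρ0 hreg hs hst ht Q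
  obtain ⟨B, hB, hz⟩ : ∃ B : ℝ, 0 < B ∧ ∀ t ∈ Icc 0 T, ‖π (x t)‖ ≤ B := by
    refine ⟨‖π‖ * (‖x 0‖ + (D T - D 0) / a) + 1, ?_, fun t ht => ?_⟩
    · have h1 := hinc 0 T le_rfl hT.le le_rfl
      have h2 : 0 ≤ a * ‖x T - x 0‖ := by positivity
      have h3 : 0 ≤ (D T - D 0) / a := div_nonneg (h2.trans h1) ha.le
      positivity
    · have h1 := hinc 0 t le_rfl ht.1 ht.2
      have h2 := hinc t T ht.1 ht.2 le_rfl
      have h3 : 0 ≤ a * ‖x T - x t‖ := by positivity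
      have h4 : ‖x t - x 0‖ ≤ (D T - D 0) / a := by
        rw [le_div_iff₀' ha]; linarith
      have h5 : ‖x t‖ ≤ ‖x 0‖ + (D T - D 0) / a := by
        have := norm_add_le (x 0) (x t - x 0)
        rw [add_sub_cancel] at this
        linarith
      have h6 := π.le_opNorm (x t)
      have h7 := mul_le_mul_of_nonneg_left h5 (norm_nonneg π)
      linarith
  obtain ⟨η, κ, hη, hη0, hκ, hκ0, hpow⟩ := hE.exists_power_bounds hT.le hB
  obtain ⟨L, hL0, hL⟩ := hE.exists_norm_fderiv_le B
  have hq : IntegrableOn (fun τ => deriv (fun s => E s (π (x τ))) τ) (Icc 0 T) := by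
    refine Integrable.mono' hκ (hE.aestronglyMeasurable_power (z := fun τ => π (x τ))
      (π.continuous.comp_aestronglyMeasurable (aestronglyMeasurable_of_mul_norm_sub_le ha hinc))) ?_
    filter_upwards [hpow, ae_restrict_mem measurableSet_Icc] with τ h1 hτ
    exact h1.2 _ (mem_closedBall_zero_iff.2 (hz τ hτ))
  have hpow1 := hpow.mono fun t h => h.1
  have hbal' : ∀ s t, 0 ≤ s → s ≤ t → t ≤ T → D t - D s = E s (π (x s)) - E t (π (x t)) +
      ∫ τ in s..t, deriv (fun s => E s (π (x τ))) τ := by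
    intro s t hs hst ht
    have hsm : s ∈ Icc 0 T := ⟨hs, hst.trans ht⟩
    have htm : t ∈ Icc 0 T := ⟨hs.trans hst, ht⟩
    have h6 := intervalIntegral.integral_add_adjacent_intervals
      (intervalIntegrable_of_integrableOn_Icc hq h0m hsm)
      (intervalIntegrable_of_integrableOn_Icc hq hsm htm)
    have h4 := hbal s hsm
    have h5 := hbal t htm
    linarith
  -- The terms with `μ` come from the estimate for `∫ ρ ≤ a`. The term `2 * B / a` covers `∫ ρ ≥ a`,
  -- where the trivial bound `2 * B` suffices.
  set m : ℝ → ℝ := fun τ => 4 / μ * η τ + (4 * L / (μ * a) + 2 * B / a) * ρ τ with hm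
  have hmi : IntegrableOn m (Icc 0 T) := (hη.const_mul _).add (hρ.const_mul _)
  have hm0 : ∀ t ∈ Icc 0 T, 0 ≤ m t := fun t ht => by
    have := hη0 t ht
    have := hρ0 t ht
    positivity
  have hshape : ∀ s t, 0 ≤ s → s ≤ t → t ≤ T → ‖π (x t) - π (x s)‖ ≤ ∫ τ in s..t, m τ := by
    intro s t hs hst ht
    have hsm : s ∈ Icc 0 T := ⟨hs, hst.trans ht⟩
    have htm : t ∈ Icc 0 T := ⟨hs.trans hst, ht⟩
    have hη' := integral_nonneg_of_mem_Icc hη0 hs hst ht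
    have hρ' := integral_nonneg_of_mem_Icc hρ0 hs hst ht
    have hint : ∫ τ in s..t, m τ = 4 / μ * (∫ τ in s..t, η τ) +
        (4 * L / (μ * a) + 2 * B / a) * ∫ τ in s..t, ρ τ := by
      rw [hm, intervalIntegral.integral_add, intervalIntegral.integral_const_mul,
        intervalIntegral.integral_const_mul]
      · exact (intervalIntegrable_of_integrableOn_Icc hη hsm htm).const_mul _
      · exact (intervalIntegrable_of_integrableOn_Icc hρ hsm htm).const_mul _
    rw [hint]
    rcases le_total (∫ τ in s..t, ρ τ) a with hr | hr
    · have h := hx.norm_shape_sub_le_of_integral_le hE hK hR hbal hD ha hb hρ hρ0 hreg hz hη hη0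
        hpow1 hq hL hμ hconv hs hst ht hr
      have e : 2 / μ * (2 * (∫ τ in s..t, η τ) + 2 * L / a * ∫ τ in s..t, ρ τ) =
          4 / μ * (∫ τ in s..t, η τ) + 4 * L / (μ * a) * ∫ τ in s..t, ρ τ := by
        field_simp; ring
      have e2 : 0 ≤ 2 * B / a * ∫ τ in s..t, ρ τ := by positivity
      linarith
    · have h1 := (norm_sub_le (π (x t)) (π (x s))).trans (add_le_add (hz t htm) (hz s hsm))
      have e2 : 2 * B ≤ 2 * B / a * ∫ τ in s..t, ρ τ := by
        rw [div_mul_eq_mul_div, le_div_iff₀ ha]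
        gcongr
      have e3 : 0 ≤ 4 / μ * (∫ τ in s..t, η τ) + 4 * L / (μ * a) * ∫ τ in s..t, ρ τ := by
        positivity
      linarith
  have hball : ∀ t ∈ Icc 0 T, π (x t) ∈ Metric.closedBall (0 : Z) B :=
    fun t ht => mem_closedBall_zero_iff.2 (hz t ht)
  have hac : AbsolutelyContinuousOnInterval x 0 T := by
    refine absolutelyContinuousOnInterval_of_norm_sub_le_integral hT.le
      (m := fun τ => a⁻¹ * (L * m τ + 2 * κ τ)) (((hmi.const_mul L).add (hκ.const_mul 2)).const_mul _)
      fun s t hs hst ht => ?_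
    have hsm : s ∈ Icc 0 T := ⟨hs, hst.trans ht⟩
    have htm : t ∈ Icc 0 T := ⟨hs.trans hst, ht⟩
    have hκi := intervalIntegrable_of_integrableOn_Icc hκ hsm htm
    rw [intervalIntegral.integral_const_mul, intervalIntegral.integral_add
      ((intervalIntegrable_of_integrableOn_Icc hmi hsm htm).const_mul _) (hκi.const_mul _),
      intervalIntegral.integral_const_mul, intervalIntegral.integral_const_mul,
      le_inv_mul_iff₀ ha]
    refine (hinc s t hs hst ht).trans ?_
    rw [hbal' s t hs hst ht]
    have hbound : ∀ w : ℝ → Z, (∀ τ ∈ Icc 0 T, w τ ∈ Metric.closedBall (0 : Z) B) →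
        |∫ τ in s..t, deriv (fun s => E s (w τ)) τ| ≤ ∫ τ in s..t, κ τ := by
      intro w hw
      rw [← Real.norm_eq_abs]
      refine intervalIntegral.norm_integral_le_of_norm_le hst ?_ hκi
      filter_upwards [(ae_restrict_iff' measurableSet_Icc).1 hpow] with τ h1 hτ
      have hτm : τ ∈ Icc 0 T := ⟨hs.trans hτ.1.le, hτ.2.trans ht⟩
      exact (h1 hτm).2 _ (hw τ hτm)
    have h1 := (abs_le.1 (hbound (fun τ => π (x τ)) hball)).2
    have h2 := (abs_le.1 (hbound (fun _ => π (x t)) fun _ _ => hball t htm)).1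
    have h2' := hE.sub_eq_integral_power hsm htm (π (x t))
    have h3 := StrongConvexOn.add_fderiv_add_le (hconv s hsm) (hE.hasFDerivAt hsm (π (x s)))
      (π (x t))
    have h4 : |fderiv ℝ (E s) (π (x s)) (π (x t) - π (x s))| ≤ L * ∫ τ in s..t, m τ := by
      rw [← Real.norm_eq_abs]
      refine (ContinuousLinearMap.le_opNorm _ _).trans ?_
      exact mul_le_mul (hL s hsm _ (hball s hsm)) (hshape s t hs hst ht) (norm_nonneg _) hL0
    have h5 := (abs_le.1 h4).1
    have h6 : 0 ≤ μ / 2 * ‖π (x t) - π (x s)‖ ^ 2 := by positivity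
    linarith
  refine ⟨hac, ?_⟩
  have hdiff : ∀ᵐ t ∂(volume.restrict (Icc 0 T)), DifferentiableAt ℝ x t := by
    have h1 := hac.boundedVariationOn.ae_differentiableAt_of_mem_uIcc
    rw [uIcc_of_le hT.le] at h1
    exact (ae_restrict_iff' measurableSet_Icc).2 h1
  have hprim : ∀ {g : ℝ → ℝ}, IntegrableOn g (Icc 0 T) → ∀ᵐ t ∂(volume.restrict (Icc 0 T)),
      HasDerivAt (fun t => ∫ τ in (0 : ℝ)..t, g τ) (g t) t := by
    intro g hg
    have h1 := (intervalIntegrable_of_integrableOn_Icc hg h0m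
      (right_mem_Icc.2 hT.le)).ae_hasDerivAt_integral
    rw [uIcc_of_le hT.le] at h1
    refine (ae_restrict_iff' measurableSet_Icc).2 ?_
    filter_upwards [h1] with t h2 ht
    exact h2 ht 0 h0m
  filter_upwards [hdiff, hprim hη, hprim hmi, hprim hρ, ae_restrict_Icc_mem_Ioo 0 T]
    with t hxt hηt hmt hρt ht
  have htm : t ∈ Icc 0 T := Ioo_subset_Icc_self ht
  set v := deriv x t
  have hv : HasDerivAt x v t := hxt.hasDerivAt
  have hquot : Tendsto (slope x t) (𝓝[<] t) (𝓝 v) :=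
    (hasDerivAt_iff_tendsto_slope_left_right.1 hv).1
  have hev : ∀ᶠ s in 𝓝[<] t, s ∈ Ioo 0 t := Ioo_mem_nhdsLT ht.1
  have hslope : ∀ s ∈ Ioo 0 t, slope x t s = (t - s)⁻¹ • (x t - x s) := by
    intro s _
    rw [slope_comm, slope_def_module]
  have hvK : v ∈ K := by
    refine hK.isClosed.mem_of_tendsto hquot ?_
    filter_upwards [hev] with s hs
    rw [hslope s hs]
    exact hK.smul_mem _ (inv_pos.2 (sub_pos.2 hs.2)) _ (hmem s t hs.1.le hs.2.le ht.2.le)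
  refine ⟨v, hv, hvK, ?_, fun u hu => hx.nonneg_force hE hK hR htm hu⟩
  -- Energy and dissipation are frozen at the right endpoint `t`, hence left quotients. Freezing the
  -- shape at `x s` in the power costs `(∫ m) * (∫ η)` over `[s,t]`, which is `o(t - s)`.
  set F : ℝ → ℝ := fun s => E t (π (x s)) with hF
  have hFd : HasDerivAt F (fderiv ℝ (E t) (π (x t)) (π v)) t :=
    (hE.hasFDerivAt htm (π (x t))).comp_hasDerivAt t (π.hasFDerivAt.comp_hasDerivAt t hv)
  have hFs := (hasDerivAt_iff_tendsto_slope_left_right.1 hFd).1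
  have hηs := (hasDerivAt_iff_tendsto_slope_left_right.1 hηt).1
  have hm' := hmt.continuousAt.tendsto.mono_left (nhdsWithin_le_nhds (s := Iio t))
  have hρ' := hρt.continuousAt.tendsto.mono_left (nhdsWithin_le_nhds (s := Iio t))
  have hcont : Continuous (Rfin t) := by
    rw [← continuousOn_univ]
    exact (hR.convex t htm).continuousOn isOpen_univ
  have hl := (hcont.tendsto v).comp hquot
  have hr := (((hρ'.const_sub (∫ τ in (0 : ℝ)..t, ρ τ)).div_const a).const_add 1).mul
    (hFs.neg.add ((hm'.const_sub (∫ τ in (0 : ℝ)..t, m τ)).mul hηs))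
  simp only [sub_self, zero_div, add_zero, one_mul, zero_mul] at hr
  have hle := le_of_tendsto_of_tendsto hl hr ?_
  · linarith
  filter_upwards [hev] with s hs
  have hsm : s ∈ Icc 0 T := ⟨hs.1.le, hs.2.le.trans ht.2.le⟩
  have hts : 0 < t - s := sub_pos.2 hs.2
  have hsub : ∀ {g : ℝ → ℝ}, IntegrableOn g (Icc 0 T) →
      (∫ τ in (0 : ℝ)..t, g τ) - ∫ τ in (0 : ℝ)..s, g τ = ∫ τ in s..t, g τ := fun hg =>
    intervalIntegral.integral_interval_sub_left (intervalIntegrable_of_integrableOn_Icc hg h0m htm)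
      (intervalIntegrable_of_integrableOn_Icc hg h0m hsm)
  have h1 := hend s t hs.1.le hs.2.le ht.2.le
  have h2 := (abs_le.1 (hE.abs_integral_power_sub_le hη hη0 hpow1 hq hz hs.1.le hs.2.le ht.2.le
    (hz s hsm) (N := ∫ τ in s..t, m τ) fun τ hτ =>
      (hshape s τ hs.1.le hτ.1 (hτ.2.trans ht.2.le)).trans
        (integral_le_integral_of_subinterval hmi hm0 hs.1.le le_rfl hτ.1 hτ.2 ht.2.le))).2
  have h3 := hbal' s t hs.1.le hs.2.le ht.2.le
  have h4 : 0 ≤ 1 + (∫ τ in s..t, ρ τ) / a := by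
    have := integral_nonneg_of_mem_Icc hρ0 hs.1.le hs.2.le ht.2.le
    positivity
  have h5 : D t - D s ≤ (F s - F t) + (∫ τ in s..t, m τ) * ∫ τ in s..t, η τ := by
    simp only [hF]; linarith
  have h6 : slope (fun t => ∫ τ in (0 : ℝ)..t, η τ) t s = (t - s)⁻¹ * ∫ τ in s..t, η τ := by
    rw [slope_comm, slope_def_module, hsub hη, smul_eq_mul]
  have h7 : slope F t s = (t - s)⁻¹ * (F t - F s) := by
    rw [slope_comm, slope_def_module, smul_eq_mul]
  simp only [Function.comp_apply]
  rw [hslope s hs, hR.homogeneous t htm _ (inv_pos.2 hts), hsub hρ, hsub hmi, h6, h7]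
  have h8 := mul_le_mul_of_nonneg_left (h1.trans (mul_le_mul_of_nonneg_left h5 h4))
    (inv_pos.2 hts).le
  refine h8.trans_eq ?_
  ring

end Energetic

end Quasistatic

/-! ### Differential solutions, monotonicity, and recovery of the position from the shape -/

namespace Quasistatic

variable {X Z : Type*} [NormedAddCommGroup X] [NormedSpace ℝ X]
  [NormedAddCommGroup Z] [NormedSpace ℝ Z]

section ForceBalance

variable {T : ℝ} {π : X →L[ℝ] Z} {E : ℝ → Z → ℝ} {K : Set X} {Rfin : ℝ → X → ℝ} {x₀ : X}
  {x y : ℝ → X}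

theorem IsDifferentialSolution.isForceBalanceSolution
    (hx : IsDifferentialSolution T (energy π E) (dissipation K Rfin) x₀ x)
    (hE : IsShapeEnergy T E) (hK : IsClosedConvexCone K) (hR : IsFiniteDissipation T Rfin) :
    IsForceBalanceSolution T π E K Rfin x := by
  refine ⟨hx.1, ?_⟩
  filter_upwards [hx.2.2, ae_restrict_mem measurableSet_Icc] with t h ht
  obtain ⟨v, hv, ξ, hξ, hsum⟩ := h
  have hcoe : ∀ w ∈ K, ((dissipation K Rfin t w : ℝ≥0∞) : EReal) = (Rfin t w : ℝ) := by
    intro w hw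
    rw [dissipation_of_mem hw, EReal.coe_ennreal_ofReal, max_eq_left (hR.nonneg ht w)]
  have hvK : v ∈ K := by
    by_contra hcon
    have h := hξ 0
    rw [dissipation_of_notMem hcon, hcoe 0 hK.zero_mem, EReal.coe_ennreal_top,
      EReal.top_add_coe] at h
    exact absurd h (not_le.2 (EReal.coe_lt_top _))
  have hineq : ∀ w ∈ K, Rfin t v + ξ (w - v) ≤ Rfin t w := by
    intro w hw
    have h := hξ w
    rw [hcoe v hvK, hcoe w hw] at h
    exact_mod_cast h
  have hfd : fderiv ℝ (energy π E t) (x t) = (fderiv ℝ (E t) (π (x t))).comp π :=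
    ((hE.hasFDerivAt ht (π (x t))).comp (x t) π.hasFDerivAt).fderiv
  have hξv : ∀ u, ξ u = -fderiv ℝ (E t) (π (x t)) (π u) := by
    intro u
    rw [eq_neg_of_add_eq_zero_left hsum, hfd]
    rfl
  refine ⟨v, hv, hvK, ?_, fun u hu => ?_⟩
  · have h := hineq 0 hK.zero_mem
    rw [zero_sub, map_neg, hξv, hR.map_zero t ht] at h
    linarith
  · have h := hineq (v + u) (hK.add_mem hvK hu)
    rw [add_sub_cancel_left, hξv] at h
    linarith [hR.add_le ht v u]

/-- Test the stability of each curve with the velocity of the other; the dissipation terms cancel.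
-/
theorem IsForceBalanceSolution.ae_monotone
    (hx : IsForceBalanceSolution T π E K Rfin x) (hy : IsForceBalanceSolution T π E K Rfin y) :
    ∀ᵐ t ∂(volume.restrict (Icc 0 T)), ∃ v w, HasDerivAt (fun s => π (x s)) v t ∧
      HasDerivAt (fun s => π (y s)) w t ∧
      (fderiv ℝ (E t) (π (x t)) - fderiv ℝ (E t) (π (y t))) (v - w) ≤ 0 := by
  filter_upwards [hx.2, hy.2] with t h1 h2
  obtain ⟨v, hv, hvK, hv1, hv2⟩ := h1
  obtain ⟨w, hw, hwK, hw1, hw2⟩ := h2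
  refine ⟨π v, π w, π.hasFDerivAt.comp_hasDerivAt t hv, π.hasFDerivAt.comp_hasDerivAt t hw, ?_⟩
  have h3 := hv2 w hwK
  have h4 := hw2 v hvK
  simp only [sub_apply, map_sub]
  linarith

/-- If the shapes agree, then condition (∗) makes the positions agree. -/
theorem IsForceBalanceSolution.eqOn_of_shape_eqOn (hT : 0 < T)
    (hx : IsForceBalanceSolution T π E K Rfin x) (hy : IsForceBalanceSolution T π E K Rfin y)
    (hstar : ∀ᵐ t ∂(volume.restrict (Icc 0 T)), CondStar π (dissipation K Rfin t))
    (h0 : x 0 = y 0) (hz : ∀ t ∈ Icc 0 T, π (x t) = π (y t)) : EqOn x y (Icc 0 T) := by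
  have hd : ∀ᵐ t, t ∈ uIcc 0 T → HasDerivAt (fun s => x s - y s) 0 t := by
    rw [uIcc_of_le hT.le, ← ae_restrict_iff' measurableSet_Icc]
    filter_upwards [hx.2, hy.2, hstar, ae_restrict_Icc_mem_Ioo 0 T] with t h1 h2 hs ht
    obtain ⟨v, hv, hvK, hv1, hv2⟩ := h1
    obtain ⟨w, hw, hwK, hw1, hw2⟩ := h2
    have hvw : π v = π w := by
      have e1 : HasDerivAt (fun s => π (x s)) (π v) t := π.hasFDerivAt.comp_hasDerivAt t hv
      have e2 : HasDerivAt (fun s => π (y s)) (π w) t := π.hasFDerivAt.comp_hasDerivAt t hw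
      refine e1.unique (e2.congr_of_eventuallyEq ?_)
      filter_upwards [Ioo_mem_nhds ht.1 ht.2] with s hs
      exact hz s (Ioo_subset_Icc_self hs)
    rw [← hz t (Ioo_subset_Icc_self ht), ← hvw] at hw1
    have hle : ∀ u, π u = π v → Rfin t v ≤ Rfin t u ∨ u ∉ K := by
      intro u hu
      by_cases huK : u ∈ K
      · have := hv2 u huK
        rw [hu] at this
        exact Or.inl (by linarith)
      · exact Or.inr huK
    -- The force sees only `π u`, so along a fibre of `π` the force balance says that `v` minimises
    -- the dissipation. The same holds for `w`.
    have hmin : ∀ u, π u = π v → dissipation K Rfin t v ≤ dissipation K Rfin t u := by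
      intro u hu
      rcases hle u hu with h | h
      · by_cases huK : u ∈ K
        · rw [dissipation_of_mem hvK, dissipation_of_mem huK]
          exact ENNReal.ofReal_le_ofReal h
        · rw [dissipation_of_notMem huK]
          exact le_top
      · rw [dissipation_of_notMem h]
        exact le_top
    have hsh : shapeRestrict π (dissipation K Rfin t) (π v) = dissipation K Rfin t v :=
      le_antisymm (iInf₂_le (f := fun u (_ : π u = π v) => dissipation K Rfin t u) v rfl)
        (le_iInf₂ hmin)
    have hwv : dissipation K Rfin t w ≤ dissipation K Rfin t v := by
      rw [dissipation_of_mem hvK, dissipation_of_mem hwK]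
      have := hv2 v hvK
      exact ENNReal.ofReal_le_ofReal (by linarith)
    obtain ⟨u, ⟨hu1, hu2, hu3⟩, -⟩ := hs (π v) (by
      rw [hsh, dissipation_of_mem hvK]; exact ENNReal.ofReal_lt_top)
    have huv : v = u := by
      by_contra hne
      exact absurd (hu3 v hne rfl) (not_lt.2 (hu2 ▸ hsh).ge)
    have huw : w = u := by
      by_contra hne
      refine absurd (hu3 w hne hvw.symm) (not_lt.2 (hwv.trans ?_))
      rw [← hu2, hsh]
    have := hv.sub hw
    rwa [huv, huw, sub_self] at this
  obtain ⟨C, hC⟩ := (hx.1.sub hy.1).const_of_ae_hasDerivAt_zero hd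
  intro t ht
  have e1 := hC 0 (by simp)
  have e2 := hC t (by rwa [uIcc_of_le hT.le])
  simp only [Pi.sub_apply, h0, sub_self] at e1 e2
  rw [← e1] at e2
  exact sub_eq_zero.1 e2

end ForceBalance

/-! ### Uniqueness of the shape: quadratic energies and energies of class `C³` -/

section Shape

variable {T : ℝ} {E : ℝ → Z → ℝ} {z w : ℝ → Z}

theorem _root_.ContDiffOn.comp_absolutelyContinuousOnInterval {V W : Type*}
    [NormedAddCommGroup V] [NormedSpace ℝ V] [NormedAddCommGroup W] [NormedSpace ℝ W]
    {φ : V → W} {S : Set V} (hφ : ContDiffOn ℝ 1 φ S) (hS : Convex ℝ S) (hS' : IsCompact S)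
    {f : ℝ → V} {a b : ℝ} (hf : AbsolutelyContinuousOnInterval f a b)
    (hfS : ∀ t ∈ uIcc a b, f t ∈ S) :
    AbsolutelyContinuousOnInterval (fun t => φ (f t)) a b := by
  obtain ⟨L, hL⟩ := hφ.exists_lipschitzOnWith one_ne_zero hS hS'
  exact hL.comp_absolutelyContinuousOnInterval hf hfS

theorem _root_.ContDiff.comp_absolutelyContinuousOnInterval {V W : Type*}
    [NormedAddCommGroup V] [NormedSpace ℝ V] [FiniteDimensional ℝ V] [NormedAddCommGroup W]
    [NormedSpace ℝ W] {φ : V → W} (hφ : ContDiff ℝ 1 φ) {f : ℝ → V} {a b : ℝ}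
    (hf : AbsolutelyContinuousOnInterval f a b) :
    AbsolutelyContinuousOnInterval (fun t => φ (f t)) a b := by
  have : ProperSpace V := FiniteDimensional.proper ℝ V
  obtain ⟨C, hC⟩ := hf.exists_bound
  exact hφ.contDiffOn.comp_absolutelyContinuousOnInterval (convex_closedBall (0 : V) C)
    (isCompact_closedBall _ _) hf fun t ht => mem_closedBall_zero_iff.2 (hC t ht)

theorem shape_eq_of_quadratic [FiniteDimensional ℝ Z] {A : Z →L[ℝ] (Z →L[ℝ] ℝ)} {l : ℝ → Z}
    (hsymm : ∀ z w, A z w = A w z) (hpos : ∀ z, z ≠ 0 → 0 < A z z)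
    (hEA : ∀ t ∈ Icc 0 T, ∀ z, E t z = 1 / 2 * A (z - l t) (z - l t))
    (hz : AbsolutelyContinuousOnInterval z 0 T) (hw : AbsolutelyContinuousOnInterval w 0 T)
    (hmono : ∀ᵐ t ∂(volume.restrict (Icc 0 T)), ∃ v₁ v₂, HasDerivAt z v₁ t ∧
      HasDerivAt w v₂ t ∧ (fderiv ℝ (E t) (z t) - fderiv ℝ (E t) (w t)) (v₁ - v₂) ≤ 0)
    (h0 : z 0 = w 0) : ∀ t ∈ Icc 0 T, z t = w t := by
  have hquad : ∀ u : Z, HasFDerivAt (fun z => 1 / 2 * A z z) (A u) u := by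
    intro u
    refine ((A.hasFDerivAt.clm_apply (hasFDerivAt_id u)).const_mul (1 / 2)).congr_fderiv ?_
    ext v
    simp [hsymm v]
    ring
  have hfd : ∀ t ∈ Icc 0 T, ∀ u, fderiv ℝ (E t) u = A (u - l t) := by
    intro t ht u
    rw [show E t = fun z => 1 / 2 * A (z - l t) (z - l t) from funext (hEA t ht)]
    exact ((hquad (u - l t)).comp u ((hasFDerivAt_id u).sub_const (l t))).fderiv
  have hac : AbsolutelyContinuousOnInterval
      (fun t => 1 / 2 * A (z t - w t) (z t - w t)) 0 T := by
    refine ContDiff.comp_absolutelyContinuousOnInterval (φ := fun u : Z => 1 / 2 * A u u) ?_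
      (hz.sub hw)
    fun_prop
  have hle := le_of_ae_deriv_nonpos hac ?_
  · intro t ht
    have h1 := hle t ht
    simp only [h0, sub_self, map_zero, mul_zero] at h1
    by_contra hne
    have := hpos (z t - w t) (sub_ne_zero.2 hne)
    linarith
  · filter_upwards [hmono, ae_restrict_mem measurableSet_Icc] with t h ht
    obtain ⟨v₁, v₂, h1, h2, h3⟩ := h
    have hd : HasDerivAt (fun s => z s - w s) (v₁ - v₂) t := h1.sub h2
    refine ⟨A (z t - w t) (v₁ - v₂),
      HasFDerivAt.comp_hasDerivAt (f := fun s => z s - w s) t (hquad (z t - w t)) hd, ?_⟩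
    rwa [hfd t ht, hfd t ht, ← map_sub, sub_sub_sub_cancel_right] at h3

theorem hasFDerivAt_slice {W : Type*} [NormedAddCommGroup W] [NormedSpace ℝ W] {F : ℝ × Z → W}
    {F' : ℝ × Z →L[ℝ] W} {I : Set ℝ} {t : ℝ} {u : Z} (ht : t ∈ I)
    (hF : HasFDerivWithinAt F F' (I ×ˢ univ) (t, u)) :
    HasFDerivAt (fun u => F (t, u)) (F'.comp (ContinuousLinearMap.inr ℝ ℝ Z)) u := by
  rw [← hasFDerivWithinAt_univ]
  exact HasFDerivWithinAt.comp u hF (hasFDerivAt_prodMk_right t u).hasFDerivWithinAt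
    fun u _ => ⟨ht, mem_univ _⟩

/-- Uniqueness of the shape for energies of class `C³`. -/
theorem shape_eq_of_contDiffOn [FiniteDimensional ℝ Z] (hT : 0 < T) (hE : IsShapeEnergy T E)
    (hC : ContDiffOn ℝ 3 (fun p : ℝ × Z => E p.1 p.2) (Icc 0 T ×ˢ univ))
    (hz : AbsolutelyContinuousOnInterval z 0 T) (hw : AbsolutelyContinuousOnInterval w 0 T)
    (hmono : ∀ᵐ t ∂(volume.restrict (Icc 0 T)), ∃ v₁ v₂, HasDerivAt z v₁ t ∧
      HasDerivAt w v₂ t ∧ (fderiv ℝ (E t) (z t) - fderiv ℝ (E t) (w t)) (v₁ - v₂) ≤ 0)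
    (h0 : z 0 = w 0) : ∀ t ∈ Icc 0 T, z t = w t := by
  have : ProperSpace Z := FiniteDimensional.proper ℝ Z
  set S : Set (ℝ × Z) := Icc 0 T ×ˢ univ with hS
  have hSu : UniqueDiffOn ℝ S := (uniqueDiffOn_Icc hT).prod uniqueDiffOn_univ
  set ι : Z →L[ℝ] ℝ × Z := ContinuousLinearMap.inr ℝ ℝ Z
  set H : ℝ × Z → (Z →L[ℝ] ℝ) :=
    fun p => (fderivWithin ℝ (fun p : ℝ × Z => E p.1 p.2) S p).comp ι with hH
  have hH2 : ContDiffOn ℝ 2 H S :=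
    (hC.fderivWithin hSu (m := 2) (by norm_num)).clm_comp contDiffOn_const
  set J : ℝ × Z → (ℝ × Z →L[ℝ] (Z →L[ℝ] ℝ)) := fun p => fderivWithin ℝ H S p
  have hJ1 : ContDiffOn ℝ 1 J S := hH2.fderivWithin hSu (m := 1) (by norm_num)
  have hHE : ∀ t ∈ Icc 0 T, ∀ u, H (t, u) = fderiv ℝ (E t) u := by
    intro t ht u
    exact (hasFDerivAt_slice ht ((hC.differentiableOn (by norm_num)) (t, u)
      ⟨ht, mem_univ _⟩).hasFDerivWithinAt).fderiv.symm
  have hHJ : ∀ t ∈ Icc 0 T, ∀ u, HasFDerivWithinAt H (J (t, u)) S (t, u) := fun t ht u =>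
    ((hH2.differentiableOn (by norm_num)) (t, u) ⟨ht, mem_univ _⟩).hasFDerivWithinAt
  have hJsymm : ∀ t ∈ Icc 0 T, ∀ u v₁ v₂, J (t, u) (ι v₁) v₂ = J (t, u) (ι v₂) v₁ := by
    intro t ht u v₁ v₂
    refine second_derivative_symmetric (f := E t) (f' := fun u => H (t, u)) (x := u)
      (f'' := (J (t, u)).comp ι) ?_ (hasFDerivAt_slice ht (hHJ t ht u)) v₁ v₂
    intro u'
    rw [hHE t ht]
    exact hE.hasFDerivAt ht u'
  obtain ⟨B₁, hB₁⟩ := hz.exists_bound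
  obtain ⟨B₂, hB₂⟩ := hw.exists_bound
  rw [uIcc_of_le hT.le] at hB₁ hB₂
  set Q : Set Z := Metric.closedBall 0 (max B₁ B₂)
  have hQz : ∀ t ∈ Icc 0 T, z t ∈ Q := fun t ht =>
    mem_closedBall_zero_iff.2 ((hB₁ t ht).trans (le_max_left _ _))
  have hQw : ∀ t ∈ Icc 0 T, w t ∈ Q := fun t ht =>
    mem_closedBall_zero_iff.2 ((hB₂ t ht).trans (le_max_right _ _))
  have hQc : Convex ℝ Q := convex_closedBall _ _
  have hQk : IsCompact Q := isCompact_closedBall _ _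
  obtain ⟨L, hL⟩ := (hJ1.mono (prod_mono_right (subset_univ Q))).exists_lipschitzOnWith
    one_ne_zero ((convex_Icc 0 T).prod hQc) (isCompact_Icc.prod hQk)
  have hJL : ∀ t ∈ Icc 0 T, ∀ u₁ ∈ Q, ∀ u₂ ∈ Q, ‖J (t, u₁) - J (t, u₂)‖ ≤ L * ‖u₁ - u₂‖ := by
    intro t ht u₁ h1 u₂ h2
    have := hL.norm_sub_le (x := (t, u₁)) ⟨ht, h1⟩ (y := (t, u₂)) ⟨ht, h2⟩
    simpa [Prod.norm_def] using this
  -- Linearising the force increment at either endpoint has a quadratic error; both are needed,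
  -- since the velocities of `z` and `w` are paired with the Hessians at `z` and `w` respectively.
  have htaylor : ∀ t ∈ Icc 0 T, ∀ u₁ ∈ Q, ∀ u₂ ∈ Q, ∀ u ∈ ({u₁, u₂} : Set Z),
      ‖H (t, u₁) - H (t, u₂) - J (t, u) (ι (u₁ - u₂))‖ ≤ L * ‖u₁ - u₂‖ * ‖u₁ - u₂‖ := by
    intro t ht u₁ h1 u₂ h2 u hu
    have huseg : u ∈ segment ℝ u₂ u₁ := by
      rcases hu with rfl | rfl
      · exact right_mem_segment _ _ _
      · exact left_mem_segment _ _ _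
    have huQ : u ∈ Q := hQc.segment_subset h2 h1 huseg
    refine (convex_segment u₂ u₁).norm_image_sub_le_of_norm_hasFDerivWithin_le'
      (f := fun u => H (t, u)) (f' := fun u => (J (t, u)).comp ι) (φ := (J (t, u)).comp ι)
      (fun u' _ => (hasFDerivAt_slice ht (hHJ t ht u')).hasFDerivWithinAt) (fun u' hu' => ?_)
      (left_mem_segment _ _ _) (right_mem_segment _ _ _)
    rw [← ContinuousLinearMap.sub_comp]
    refine (ContinuousLinearMap.opNorm_comp_le _ _).trans ?_
    have hι : ‖ι‖ ≤ 1 := ContinuousLinearMap.norm_inr_le_one ℝ ℝ Z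
    refine (mul_le_of_le_one_right (norm_nonneg _) hι).trans ?_
    refine (hJL t ht _ (hQc.segment_subset h2 h1 hu') _ huQ).trans ?_
    gcongr
    have hd : ∀ p ∈ segment ℝ u₂ u₁, ∀ q ∈ ({u₁, u₂} : Set Z), ‖p - q‖ ≤ ‖u₁ - u₂‖ := by
      intro p hp q hq
      rcases hq with rfl | rfl
      · rw [norm_sub_rev]
        obtain ⟨a, b, ha, hb, hab, rfl⟩ := hp
        rw [show q - (a • u₂ + b • q) = a • (q - u₂) by
          rw [eq_sub_of_add_eq' hab, sub_smul, one_smul, smul_sub]; abel, norm_smul,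
          Real.norm_of_nonneg ha]
        exact mul_le_of_le_one_left (norm_nonneg _) (by linarith)
      · obtain ⟨a, b, ha, hb, hab, rfl⟩ := hp
        rw [show a • q + b • u₁ - q = b • (u₁ - q) by
          rw [eq_sub_of_add_eq hab, sub_smul, one_smul, smul_sub]; abel, norm_smul,
          Real.norm_of_nonneg hb]
        exact mul_le_of_le_one_left (norm_nonneg _) (by linarith)
    exact hd u' hu' u hu
  obtain ⟨μ, hμ, hconv⟩ := hE.uniformConvex
  obtain ⟨k₁, hk₁, hk₁'⟩ := exists_integrableOn_norm_deriv_le hT.le hz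
  obtain ⟨k₂, hk₂, hk₂'⟩ := exists_integrableOn_norm_deriv_le hT.le hw
  set Γ : ℝ × (Z × Z) → ℝ := fun p => (H (p.1, p.2.1) - H (p.1, p.2.2)) (p.2.1 - p.2.2) with hΓ
  have hΓ1 : ContDiffOn ℝ 1 Γ (Icc 0 T ×ˢ (Q ×ˢ Q)) := by
    have hH1 : ContDiffOn ℝ 1 H S := hH2.of_le (by norm_num)
    refine ContDiffOn.clm_apply (ContDiffOn.sub ?_ ?_) (ContDiff.contDiffOn (by fun_prop))
    · exact hH1.comp (f := fun p : ℝ × (Z × Z) => (p.1, p.2.1))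
        (ContDiff.contDiffOn (by fun_prop)) fun p hp => ⟨hp.1, mem_univ _⟩
    · exact hH1.comp (f := fun p : ℝ × (Z × Z) => (p.1, p.2.2))
        (ContDiff.contDiffOn (by fun_prop)) fun p hp => ⟨hp.1, mem_univ _⟩
  have hac : AbsolutelyContinuousOnInterval (fun t => Γ (t, (z t, w t))) 0 T := by
    refine hΓ1.comp_absolutelyContinuousOnInterval ((convex_Icc 0 T).prod (hQc.prod hQc))
      (isCompact_Icc.prod (hQk.prod hQk)) (absolutelyContinuousOnInterval_prodMk
        (absolutelyContinuousOnInterval_id 0 T) (absolutelyContinuousOnInterval_prodMk hz hw)) ?_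
    rw [uIcc_of_le hT.le]
    exact fun t ht => ⟨ht, hQz t ht, hQw t ht⟩
  have hcoer : ∀ t ∈ Icc 0 T, μ * ‖z t - w t‖ ^ 2 ≤ Γ (t, (z t, w t)) := by
    intro t ht
    simp only [hΓ, hHE t ht]
    exact mul_norm_sub_sq_le_fderiv_sub (hconv t ht) (hE.hasFDerivAt ht _) (hE.hasFDerivAt ht _)
  have hle := nonpos_of_ae_deriv_le_mul hT.le hac (k := fun t => L / μ * (1 + k₁ t + k₂ t))
    ((((integrable_const 1).add hk₁).add hk₂).const_mul _) ?_ (by simp [hΓ, h0])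
  · intro t ht
    have h1 := (hcoer t ht).trans (hle t ht)
    have h2 : ‖z t - w t‖ ^ 2 ≤ 0 := by
      by_contra! hpos
      nlinarith [mul_pos hμ hpos]
    have h3 : ‖z t - w t‖ = 0 := by
      have := sq_nonneg ‖z t - w t‖
      exact pow_eq_zero_iff two_ne_zero |>.1 (le_antisymm h2 this)
    exact sub_eq_zero.1 (norm_eq_zero.1 h3)
  · filter_upwards [hmono, ae_restrict_Icc_mem_Ioo 0 T] with t h ht'
    obtain ⟨v₁, v₂, h1, h2, h3⟩ := h
    have ht := Ioo_subset_Icc_self ht'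
    have hd : ∀ {ζ : ℝ → Z} {v : Z}, HasDerivAt ζ v t →
        HasDerivAt (fun s => H (s, ζ s)) (J (t, ζ t) (1, v)) t := by
      intro ζ v hζ
      refine ((hHJ t ht (ζ t)).hasFDerivAt ?_).comp_hasDerivAt t ((hasDerivAt_id t).prodMk hζ)
      exact prod_mem_nhds (Icc_mem_nhds ht'.1 ht'.2) univ_mem
    have hder : HasDerivAt (fun s => Γ (s, (z s, w s)))
        ((J (t, z t) (1, v₁) - J (t, w t) (1, v₂)) (z t - w t) +
          (H (t, z t) - H (t, w t)) (v₁ - v₂)) t :=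
      HasDerivAt.clm_apply (c := fun s => H (s, z s) - H (s, w s)) (u := fun s => z s - w s)
        ((hd h1).sub (hd h2)) (h1.sub h2)
    refine ⟨_, hder, ?_⟩
    set u := z t - w t with hu
    set Y := H (t, z t) - H (t, w t) with hY
    rw [← hHE t ht, ← hHE t ht, ← hY] at h3
    -- Symmetry of the Hessian moves `u` into the first slot. Up to errors `O(‖u‖²)` weighted by `1
    -- + ‖v₁‖ + ‖v₂‖`, the derivative of `Γ` becomes `2 * Y (v₁ - v₂)`, which is nonpositive;
    -- coercivity of `Γ` absorbs the errors.
    have hsplit : ∀ p v, J (t, p) (1, v) u = J (t, p) (1, 0) u + J (t, p) (ι u) v := by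
      intro p v
      rw [hJsymm t ht p u v, ← add_apply, ← map_add]
      simp [ι]
    have e1 : |(J (t, z t) - J (t, w t)) (1, 0) u| ≤ L * ‖u‖ * ‖u‖ := by
      rw [← Real.norm_eq_abs]
      refine (ContinuousLinearMap.le_opNorm₂ _ _ _).trans ?_
      have := hJL t ht _ (hQz t ht) _ (hQw t ht)
      rw [show ‖((1 : ℝ), (0 : Z))‖ = 1 by simp [Prod.norm_def], mul_one]
      gcongr
    have e2 : ∀ p ∈ ({z t, w t} : Set Z), ∀ v, |(Y - J (t, p) (ι u)) v| ≤ L * ‖u‖ * ‖u‖ * ‖v‖ := by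
      intro p hp v
      rw [← Real.norm_eq_abs]
      refine (ContinuousLinearMap.le_opNorm _ _).trans ?_
      have := htaylor t ht _ (hQz t ht) _ (hQw t ht) p hp
      gcongr
    have e3 := (abs_le.1 e1).2
    have e4 := (abs_le.1 (e2 (z t) (by simp) v₁)).1
    have e5 := (abs_le.1 (e2 (w t) (by simp) v₂)).2
    simp only [sub_apply, map_sub] at e3 e4 e5 h3 ⊢
    rw [hsplit (z t) v₁, hsplit (w t) v₂]
    have e6 : L * ‖u‖ * ‖u‖ * ‖v₁‖ ≤ L * ‖u‖ * ‖u‖ * k₁ t := by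
      gcongr
      exact hk₁' t v₁ h1
    have e7 : L * ‖u‖ * ‖u‖ * ‖v₂‖ ≤ L * ‖u‖ * ‖u‖ * k₂ t := by
      gcongr
      exact hk₂' t v₂ h2
    have hk : 0 ≤ 1 + k₁ t + k₂ t := by
      linarith [(norm_nonneg _).trans (hk₁' t v₁ h1), (norm_nonneg _).trans (hk₂' t v₂ h2)]
    have e8 : L / μ * (1 + k₁ t + k₂ t) * (μ * ‖u‖ ^ 2) ≤
        L / μ * (1 + k₁ t + k₂ t) * Γ (t, (z t, w t)) := by
      have := hcoer t ht
      gcongr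
    have e9 : L / μ * (1 + k₁ t + k₂ t) * (μ * ‖u‖ ^ 2) =
        L * ‖u‖ * ‖u‖ * (1 + k₁ t + k₂ t) := by
      field_simp
    linarith

end Shape

end Quasistatic

namespace Quasistatic

variable {X Z : Type*} [NormedAddCommGroup X] [NormedSpace ℝ X]
  [NormedAddCommGroup Z] [NormedSpace ℝ Z]

/-! ### Uniqueness of the shape: convex stable sets -/

section StableSet

variable {T : ℝ} {π : X →L[ℝ] Z} {E : ℝ → Z → ℝ} {K : Set X} {Rfin : ℝ → X → ℝ}
  {x y : ℝ → X}

/-- Convexity places the energy above its tangent, so the local force bound is already global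
stability. -/
theorem mem_stableSet_of_nonneg_force (hE : IsShapeEnergy T E)
    (hR : IsFiniteDissipation T Rfin) {t : ℝ} (ht : t ∈ Icc 0 T) {z : Z}
    (h : ∀ u ∈ K, 0 ≤ Rfin t u + fderiv ℝ (E t) z (π u)) :
    z ∈ stableSet E (fun s => shapeRestrict π (dissipation K Rfin s)) t := by
  intro w
  rw [← tsub_le_iff_left]
  refine le_iInf₂ fun u hu => ?_
  rw [tsub_le_iff_left]
  by_cases huK : u ∈ K
  · obtain ⟨μ, hμ, hconv⟩ := hE.uniformConvex
    have h1 := StrongConvexOn.add_fderiv_add_le (hconv t ht) (hE.hasFDerivAt ht z) w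
    have h2 := h u huK
    rw [hu] at h2
    have h3 : 0 ≤ μ / 2 * ‖w - z‖ ^ 2 := by positivity
    rw [dissipation_of_mem huK, ← ENNReal.ofReal_add (hE.nonneg t ht _) (hR.nonneg ht u)]
    exact ENNReal.ofReal_le_ofReal (by linarith)
  · rw [dissipation_of_notMem huK, add_top]
    exact le_top

theorem nonneg_force_of_mem_stableSet (hE : IsShapeEnergy T E) (hK : IsClosedConvexCone K)
    (hR : IsFiniteDissipation T Rfin) {t : ℝ} (ht : t ∈ Icc 0 T) {z : Z}
    (hz : z ∈ stableSet E (fun s => shapeRestrict π (dissipation K Rfin s)) t) {u : X}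
    (hu : u ∈ K) : 0 ≤ Rfin t u + fderiv ℝ (E t) z (π u) := by
  refine nonneg_add_fderiv_of_stable (hE.hasFDerivAt ht z) fun θ hθ => ?_
  have huK := hK.smul_mem θ hθ u hu
  have h1 : shapeRestrict π (dissipation K Rfin t) (π (θ • u)) ≤ ENNReal.ofReal (θ * Rfin t u) := by
    rw [← hR.homogeneous t ht θ hθ, ← dissipation_of_mem huK]
    exact iInf₂_le (f := fun v (_ : π v = π (θ • u)) => dissipation K Rfin t v) (θ • u) rfl
  have h2 := hz (z + θ • π u)
  rw [add_sub_cancel_left, ← map_smul] at h2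
  have h3 : 0 ≤ θ * Rfin t u := mul_nonneg hθ.le (hR.nonneg ht u)
  have h4 := h2.trans (add_le_add_right h1 _)
  rw [← ENNReal.ofReal_add (hE.nonneg t ht _) h3] at h4
  rw [← map_smul]
  exact (ENNReal.ofReal_le_ofReal_iff (add_nonneg (hE.nonneg t ht _) h3)).1 h4

/-- Uniqueness of the shape when the stable sets are convex. -/
theorem IsForceBalanceSolution.shape_eq_of_convex_stableSet [FiniteDimensional ℝ Z] (hT : 0 < T)
    (hE : IsShapeEnergy T E) (hK : IsClosedConvexCone K)
    (hR : IsFiniteDissipation T Rfin) {V : Z → ℝ} {g : ℝ → (Z →L[ℝ] ℝ)}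
    (hV : StrictConvexOn ℝ univ V) (hEV : ∀ t ∈ Icc 0 T, ∀ z, E t z = V z - g t z)
    (hconv : ∀ t ∈ Icc 0 T,
      Convex ℝ (stableSet E (fun s => shapeRestrict π (dissipation K Rfin s)) t))
    (hx : IsForceBalanceSolution T π E K Rfin x) (hy : IsForceBalanceSolution T π E K Rfin y)
    (h0 : x 0 = y 0) : ∀ t ∈ Icc 0 T, π (x t) = π (y t) := by
  have hVE : ∀ t ∈ Icc 0 T, ∀ z, HasFDerivAt V (fderiv ℝ (E t) z + g t) z := by
    intro t ht z
    have h1 : V = fun z => E t z + g t z := by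
      funext z
      rw [hEV t ht z]
      ring
    rw [h1]
    exact (hE.hasFDerivAt ht z).add (g t).hasFDerivAt
  have h0m : (0 : ℝ) ∈ Icc 0 T := left_mem_Icc.2 hT.le
  have hV1 : ContDiff ℝ 1 V := by
    rw [contDiff_one_iff_fderiv]
    refine ⟨fun z => (hVE 0 h0m z).differentiableAt, ?_⟩
    have h1 : fderiv ℝ V = fun z => fderiv ℝ (E 0) z + g 0 := funext fun z => (hVE 0 h0m z).fderiv
    rw [h1]
    have h2 : Continuous fun z => fderiv ℝ (E 0) z := by
      have := hE.continuous_fderiv.comp (f := fun z : Z => ((0 : ℝ), z)) (s := univ)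
        (by fun_prop) fun z _ => ⟨h0m, mem_univ _⟩
      exact continuousOn_univ.1 this
    exact h2.add continuous_const
  have hzx := absolutelyContinuousOnInterval_clm_comp π hx.1
  have hzy := absolutelyContinuousOnInterval_clm_comp π hy.1
  -- The midpoint convexity gap: strict convexity makes it positive unless the shapes coincide. In
  -- its derivative along the curves the load `g` cancels by linearity, so `g` is never
  -- differentiated.
  set φ : Z × Z → ℝ := fun p => 1 / 2 * V p.1 + 1 / 2 * V p.2 -
    V ((1 / 2 : ℝ) • p.1 + (1 / 2 : ℝ) • p.2) with hφ
  have hφ1 : ContDiff ℝ 1 φ := by fun_prop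
  have hac := hφ1.comp_absolutelyContinuousOnInterval
    (absolutelyContinuousOnInterval_prodMk hzx hzy)
  have hle := le_of_ae_deriv_nonpos hac ?_
  · intro t ht
    have h1 := hle t ht
    by_contra hne
    have hc := hV.2
    have h2 := hc (mem_univ (π (x t))) (mem_univ (π (y t))) hne
      (a := 1 / 2) (b := 1 / 2) (by norm_num) (by norm_num) (by norm_num)
    simp only [hφ, h0, ← add_smul, ← add_mul, smul_eq_mul] at h1 h2
    norm_num at h1
    linarith
  · filter_upwards [hx.2, hy.2, ae_restrict_mem measurableSet_Icc] with t h1 h2 ht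
    obtain ⟨v, hv, hvK, hv1, hv2⟩ := h1
    obtain ⟨w, hw, hwK, hw1, hw2⟩ := h2
    have hd1 : HasDerivAt (fun s => π (x s)) (π v) t := π.hasFDerivAt.comp_hasDerivAt t hv
    have hd2 : HasDerivAt (fun s => π (y s)) (π w) t := π.hasFDerivAt.comp_hasDerivAt t hw
    have hdm := (hd1.const_smul (1 / 2 : ℝ)).add (hd2.const_smul (1 / 2 : ℝ))
    have hd := ((((hVE t ht (π (x t))).comp_hasDerivAt t hd1).const_mul (1 / 2)).add
      (((hVE t ht (π (y t))).comp_hasDerivAt t hd2).const_mul (1 / 2))).sub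
      ((hVE t ht ((1 / 2 : ℝ) • π (x t) + (1 / 2 : ℝ) • π (y t))).comp_hasDerivAt t hdm)
    refine ⟨_, hd, ?_⟩
    -- The midpoint shape is stable by convexity of the stable set, so its force can be tested with
    -- the averaged velocity, whose dissipation is at most the average of the two.
    have hst := hconv t ht (mem_stableSet_of_nonneg_force hE hR ht hv2)
      (mem_stableSet_of_nonneg_force hE hR ht hw2) (a := 1 / 2) (b := 1 / 2)
      (by norm_num) (by norm_num) (by norm_num)
    have hmK := hK.convex hvK hwK (a := 1 / 2) (b := 1 / 2)
      (by norm_num) (by norm_num) (by norm_num)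
    have h3 := nonneg_force_of_mem_stableSet hE hK hR ht hst hmK
    have hc := (hR.convex t ht).2
    have h4 := hc (mem_univ v) (mem_univ w) (a := 1 / 2) (b := 1 / 2)
      (by norm_num) (by norm_num) (by norm_num)
    simp only [map_add, map_smul, smul_eq_mul, add_apply] at h3 h4 ⊢
    linarith

end StableSet

/-- Uniqueness for the force balance under each of the three structural conditions. -/
theorem IsForceBalanceSolution.eqOn [FiniteDimensional ℝ Z] {T : ℝ} (hT : 0 < T)
    {π : X →L[ℝ] Z} {E : ℝ → Z → ℝ} (hE : IsShapeEnergy T E)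
    {K : Set X} (hK : IsClosedConvexCone K) {Rfin : ℝ → X → ℝ} (hR : IsFiniteDissipation T Rfin)
    (hU : CondU1 T E (dissipation K Rfin) ∨ CondU2 T π E (dissipation K Rfin) ∨ CondU3 T K E)
    (hstar : ∀ᵐ t ∂(volume.restrict (Icc 0 T)), CondStar π (dissipation K Rfin t))
    {x y : ℝ → X} (hx : IsForceBalanceSolution T π E K Rfin x)
    (hy : IsForceBalanceSolution T π E K Rfin y) (h0 : x 0 = y 0) : EqOn x y (Icc 0 T) := by
  refine hx.eqOn_of_shape_eqOn hT hy hstar h0 ?_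
  have hzx := absolutelyContinuousOnInterval_clm_comp π hx.1
  have hzy := absolutelyContinuousOnInterval_clm_comp π hy.1
  rcases hU with ⟨-, hC⟩ | ⟨-, ⟨V, g, hV, -, hEV⟩, hconv⟩ | ⟨-, A, l, hsymm, hpos, -, -, hEA⟩
  · exact shape_eq_of_contDiffOn hT hE hC hzx hzy (hx.ae_monotone hy) (by rw [h0])
  · exact hx.shape_eq_of_convex_stableSet hT hE hK hR hV hEV hconv hy h0
  · exact shape_eq_of_quadratic hsymm hpos hEA hzx hzy (hx.ae_monotone hy) (by rw [h0])

end Quasistatic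

theorem mainTheorem4 {X Z : Type*} [NormedAddCommGroup X] [NormedSpace ℝ X]
    [FiniteDimensional ℝ X] [NormedAddCommGroup Z] [NormedSpace ℝ Z] [FiniteDimensional ℝ Z]
    (T : ℝ) (hT : 0 < T)
    (π : X →L[ℝ] Z) (hπ : Function.Surjective π)
    (E : ℝ → Z → ℝ) (hE : Quasistatic.IsShapeEnergy T E)
    (K : Set X) (hK : Quasistatic.IsClosedConvexCone K)
    (Rfin : ℝ → X → ℝ) (hR : Quasistatic.IsFiniteDissipation T Rfin)
    (hU : Quasistatic.CondU1 T E (Quasistatic.dissipation K Rfin) ∨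
      Quasistatic.CondU2 T π E (Quasistatic.dissipation K Rfin) ∨
      Quasistatic.CondU3 T K E)
    (hstar : ∀ᵐ t ∂(MeasureTheory.volume.restrict (Set.Icc 0 T)),
      Quasistatic.CondStar π (Quasistatic.dissipation K Rfin t))
    (x₀ : X) :
    (∀ x y : ℝ → X,
      Quasistatic.IsDifferentialSolution T (Quasistatic.energy π E)
        (Quasistatic.dissipation K Rfin) x₀ x →
      Quasistatic.IsDifferentialSolution T (Quasistatic.energy π E)
        (Quasistatic.dissipation K Rfin) x₀ y →
      Set.EqOn x y (Set.Icc 0 T)) ∧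
    (∀ x y : ℝ → X,
      Quasistatic.IsEnergeticSolution T (Quasistatic.energy π E)
        (Quasistatic.dissipation K Rfin) x₀ x →
      Quasistatic.IsEnergeticSolution T (Quasistatic.energy π E)
        (Quasistatic.dissipation K Rfin) x₀ y →
      Set.EqOn x y (Set.Icc 0 T)) := by
  refine ⟨fun x y hx hy => ?_, fun x y hx hy => ?_⟩
  · exact (hx.isForceBalanceSolution hE hK hR).eqOn hT hE hK hR hU hstar
      (hy.isForceBalanceSolution hE hK hR) (hx.2.1.trans hy.2.1.symm)
  · exact (hx.isForceBalanceSolution hT hE hK hR).eqOn hT hE hK hR hU hstar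
      (hy.isForceBalanceSolution hT hE hK hR) (hx.initial.trans hy.initial.symm)
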